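/- Let $\mathcal{C}$ be a small coherent category (finite limits, pullback-stable effective epi–mono factorizations, and pullback-stable finite unions of subobjects). A prime filter on $x\in\mathcal{C}$ is a prime filter $p$ on the distributive lattice $\mathrm{Sub}_{\mathcal{C}}(x)$. For such $p$ and $y\in\mathcal{C}$, a $p$-germ of maps $x\to y$ is an equivalence class $[f]$ of partial maps $f:x\supseteq u\to y$ with $u\in p$, where two partial maps are identified if they agree on some member of $p$ on which both are defined; put $f_!p=\{v\in \mathrm{Sub}_{\mathcal{C}}(y): f^{-1}(v)\in p\}$. Let $Spec(\mathcal{C})$ be the category whose objects are the pairs $(x,p)$ with $x\in\mathcal{C}$ and $p$ a prime filter on $x$, and whose morphisms $(x,p)\to(y,q)$ are the $p$-germs $[f]$ of maps $x\to y$ with $q\subseteq f_!p$. Let $\tau_E$ be the Grothendieck topology on $Spec(\mathcal{C})$ generated by the families $\big([f]:(x,p)\to(y,q)\big)_{p:\ f_!p\supseteq q}$, where $f:x\to y$ is an effective epimorphism of $\mathcal{C}$ and $q$ is a prime filter on $y$. Write $Y$ for the Yoneda embedding of $Spec(\mathcal{C})$ and $\#$ for $\tau_E$-sheafification, and let $\varphi:\mathcal{C}\to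 Sh(Spec(\mathcal{C}),\tau_E)$ send $y$ to the sheafification of the presheaf $Spec(\mathcal{C})(-,y)$, which takes $(x,p)$ to the set of $p$-germs of maps $x\to y$. Then: (i) $\varphi$ is coherent, i.e. it preserves finite limits, effective epimorphisms and finite unions of subobjects. (ii) Let $\mathcal{E}$ be a Grothendieck topos in which every object is a union of $\bigvee$-indecomposable subobjects (a subobject $a$ is $\bigvee$-indecomposable if $a=\bigvee_{i\in I} a_i$, with $I$ possibly empty, implies $a=a_i$ for some $i$). Then precomposition with $\varphi$ is an equivalence of categories $$\varphi^{\circ}: Fun^*_{p_\infty}(Sh(Spec(\mathcal{C}),\tau_E),\mathcal{E})\to \mathbf{Coh}(\mathcal{C},\mathcal{E}).$$ Here $\mathbf{Coh}(\mathcal{C},\mathcal{E})$ is the category of coherent functors and all natural transformations, and $Fun^*_{p_\infty}$ is the category, again with all natural transformations, of those functors $M:Sh(Spec(\mathcal{C}),\tau_E)\to\mathcal{E}$ that preserve finite limits and small colimits and such that, for every $x\in\mathcal{C}$ and every well-ordered chain $(p_0\subseteq p_1\subseteq\dots\subseteq p_\alpha\subseteq\dots)_{\alpha<\lambda}$ ($\lambda\ge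 1$) of prime filters on $x$ with union $p_\lambda$, the cone formed by the maps $M(\#Y(x,p_\lambda))\to M(\#Y(x,p_\alpha))$, $\alpha<\lambda$, induced by $[\mathrm{id}_x]$, is a limit cone in $\mathcal{E}$, i.e. $M(\#Y(x,p_\lambda))$ is the intersection of the $M(\#Y(x,p_\alpha))$. -/

import Mathlib

open CategoryTheory CategoryTheory.Limits Opposite

universe v u v₁ u₁

noncomputable section

namespace PrimeSpec

/-! ### Coherent categories and coherent functors -/

section Coherent

/-- A coherent category: a regular category (finite limits and pullback-stable effective
epi - mono factorizations) whose subobject posets have finite unions, i.e. a least element and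
binary joins, which are preserved by pulling back along arbitrary morphisms. -/
class CoherentCategory (C : Type u) [Category.{v} C] : Prop extends Regular C where
  exists_isBot : ∀ x : C, ∃ w : Subobject x, IsBot w
  exists_isLUB : ∀ {x : C} (u v : Subobject x), ∃ w, IsLUB {u, v} w
  isBot_pullback : ∀ {x y : C} (f : x ⟶ y) (w : Subobject y),
    IsBot w → IsBot ((Subobject.pullback f).obj w)
  isLUB_pullback : ∀ {x y : C} (f : x ⟶ y) (u v w : Subobject y), IsLUB {u, v} w →
    IsLUB {(Subobject.pullback f).obj u, (Subobject.pullback f).obj v}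
      ((Subobject.pullback f).obj w)

variable {C : Type u} [Category.{v} C] {D : Type u₁} [Category.{v₁} D]

/-- The subobject `F u` of `F x`, for a subobject `u` of `x` and a functor `F` that preserves
monomorphisms. -/
def mapSubobject (F : C ⥤ D) [F.PreservesMonomorphisms] {x : C} (u : Subobject x) :
    Subobject (F.obj x) :=
  Subobject.mk (F.map u.arrow)

/-- A coherent functor preserves finite limits, effective epimorphisms and finite unions of
subobjects. -/
structure IsCoherentFunctor (F : C ⥤ D) : Prop where
  [lex : PreservesFiniteLimits F]
  effectiveEpi : F.PreservesEffectiveEpis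
  isBot : ∀ {x : C} (w : Subobject x), IsBot w → IsBot (mapSubobject F w)
  isLUB : ∀ {x : C} (u v w : Subobject x), IsLUB {u, v} w →
    IsLUB {mapSubobject F u, mapSubobject F v} (mapSubobject F w)

variable (C D) in
/-- The property of functors `C ⥤ D` of being coherent; its full subcategory is `Coh(C, D)`. -/
def coherentFunctors : ObjectProperty (C ⥤ D) := fun F => IsCoherentFunctor F

end Coherent

/-! ### Grothendieck toposes generated by primes -/

section Topos

/-- A Grothendieck topos (relative to the universe `u` of small sets): a category equivalent to
the category of sheaves of sets on some small site. -/
class IsGrothendieckTopos (E : Type u₁) [Category.{v₁} E] : Prop where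
  exists_site : ∃ (D : Type u) (_ : SmallCategory D) (J : GrothendieckTopology D),
    Nonempty (E ≌ Sheaf J (Type u))

variable {E : Type u₁} [Category.{v₁} E]

/-- A subobject `a` is a prime (is `⋁`-indecomposable) if, whenever it is the union of a set `T`
of subobjects, it belongs to `T`. (Taking `T = ∅`, it is not the least subobject.) -/
def IsPrimeSubobject {X : E} (a : Subobject X) : Prop :=
  ∀ T : Set (Subobject X), IsLUB T a → a ∈ T

variable (E) in
/-- Every object is the union of some of its prime subobjects. -/
def IsPrimeGenerated : Prop :=
  ∀ X : E, ∃ S : Set (Subobject X), (∀ a ∈ S, IsPrimeSubobject a) ∧ IsLUB S ⊤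

end Topos

/-! ### Prime filters, germs, and the category of prime filters -/

section Spec

variable {C : Type u} [Category.{v} C]

/-- Prime filters on the poset of subobjects of `x`, ordered by inclusion. -/
abbrev PrimeFilter (x : C) : Type (max u v) :=
  {p : Order.PFilter (Subobject x) // p.IsPrime}

/-- A partial map `x ⊇ dom ⟶ y` whose domain belongs to `p`. -/
structure PartialHom {x : C} (p : PrimeFilter x) (y : C) where
  dom : Subobject x
  mem : dom ∈ p.1
  map : (dom : C) ⟶ y

namespace PartialHom

variable {x y : C} {p : PrimeFilter x}

/-- Two partial maps are identified when they agree on some member of `p` on which both are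
defined. -/
def Rel (f g : PartialHom p y) : Prop :=
  ∃ w ∈ p.1, ∃ (hf : w ≤ f.dom) (hg : w ≤ g.dom),
    Subobject.ofLE w f.dom hf ≫ f.map = Subobject.ofLE w g.dom hg ≫ g.map

instance setoid (p : PrimeFilter x) (y : C) [HasPullbacks C] : Setoid (PartialHom p y) where
  r := Rel
  iseqv :=
    { refl := fun f => ⟨f.dom, f.mem, le_rfl, le_rfl, rfl⟩
      symm := fun ⟨w, hw, hf, hg, h⟩ => ⟨w, hw, hg, hf, h.symm⟩
      trans := by
        rintro f g k ⟨w, hw, hf, hg, h⟩ ⟨w', hw', hg', hk, h'⟩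
        refine ⟨w ⊓ w', Order.PFilter.inf_mem hw hw', inf_le_left.trans hf,
          inf_le_right.trans hk, ?_⟩
        rw [← Subobject.ofLE_comp_ofLE _ w _ inf_le_left hf, Category.assoc, h,
          ← Subobject.ofLE_comp_ofLE _ w' _ inf_le_right hk, Category.assoc, ← h',
          Subobject.ofLE_comp_ofLE_assoc, Subobject.ofLE_comp_ofLE_assoc] }

variable [HasPullbacks C]

/-- The inverse image `f⁻¹(v)`, a subobject of `x`, of a subobject `v` of `y` under a partial map
`f : x ⊇ dom ⟶ y`. -/
def preimage (f : PartialHom p y) (v : Subobject y) : Subobject x :=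
  Subobject.mk (((Subobject.pullback f.map).obj v).arrow ≫ f.dom.arrow)

lemma preimage_le_dom (f : PartialHom p y) (v : Subobject y) : f.preimage v ≤ f.dom :=
  Subobject.mk_le_of_comm ((Subobject.pullback f.map).obj v).arrow rfl

/-- The restriction `f⁻¹(v) ⟶ v` of a partial map `f`. -/
def restrict (f : PartialHom p y) (v : Subobject y) : (f.preimage v : C) ⟶ (v : C) :=
  (Subobject.underlyingIso _).hom ≫ Subobject.pullbackπ f.map v

lemma restrict_arrow (f : PartialHom p y) (v : Subobject y) :
    f.restrict v ≫ v.arrow = Subobject.ofLE _ _ (f.preimage_le_dom v) ≫ f.map := by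
  have h : (Subobject.underlyingIso
      (((Subobject.pullback f.map).obj v).arrow ≫ f.dom.arrow)).hom ≫
        ((Subobject.pullback f.map).obj v).arrow = Subobject.ofLE _ _ (f.preimage_le_dom v) :=
    (cancel_mono f.dom.arrow).1 ((Category.assoc _ _ _).trans
      ((Subobject.underlyingIso_hom_comp_eq_mk _).trans (Subobject.ofLE_arrow _).symm))
  exact (Category.assoc _ _ _).trans ((congrArg (_ ≫ ·) (Subobject.isPullback f.map v).w).trans
    ((Category.assoc _ _ _).symm.trans (congrArg (· ≫ f.map) h)))

/-- A subobject on which `f` is defined and takes values in `v` is contained in `f⁻¹(v)`. -/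
lemma le_preimage (f : PartialHom p y) (v : Subobject y) {w : Subobject x} (hw : w ≤ f.dom)
    (k : (w : C) ⟶ (v : C)) (hk : k ≫ v.arrow = Subobject.ofLE w f.dom hw ≫ f.map) :
    w ≤ f.preimage v :=
  Subobject.le_mk_of_comm ((Subobject.isPullback f.map v).lift k (Subobject.ofLE w f.dom hw) hk)
    (by rw [← Category.assoc, (Subobject.isPullback f.map v).lift_snd, Subobject.ofLE_arrow])

lemma preimage_mem_of_rel {f g : PartialHom p y} (h : Rel f g) {v : Subobject y}
    (hv : f.preimage v ∈ p.1) : g.preimage v ∈ p.1 := by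
  obtain ⟨w, hw, hf, hg, e⟩ := h
  refine Order.PFilter.mem_of_le ?_ (Order.PFilter.inf_mem hw hv)
  refine g.le_preimage v (inf_le_left.trans hg)
    (Subobject.ofLE _ _ inf_le_right ≫ f.restrict v) ?_
  rw [Category.assoc, restrict_arrow, Subobject.ofLE_comp_ofLE_assoc,
    ← Subobject.ofLE_comp_ofLE _ w _ inf_le_left hg, Category.assoc, ← e,
    Subobject.ofLE_comp_ofLE_assoc]

lemma preimage_mono (f : PartialHom p y) {v v' : Subobject y} (h : v ≤ v') :
    f.preimage v ≤ f.preimage v' :=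
  f.le_preimage v' (f.preimage_le_dom v) (f.restrict v ≫ Subobject.ofLE v v' h)
    (by rw [Category.assoc, Subobject.ofLE_arrow, restrict_arrow])

/-- A morphism `x ⟶ y`, as a partial map defined on all of `x`. -/
def ofHom (p : PrimeFilter x) (f : x ⟶ y) : PartialHom p y where
  dom := ⊤
  mem := Order.PFilter.top_mem
  map := (⊤ : Subobject x).arrow ≫ f

lemma ofHom_preimage (p : PrimeFilter x) (f : x ⟶ y) (v : Subobject y) :
    (ofHom p f).preimage v = (Subobject.pullback f).obj v := by
  apply le_antisymm
  · refine Subobject.le_of_comm ((Subobject.isPullback f v).lift ((ofHom p f).restrict v)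
      ((ofHom p f).preimage v).arrow ?_) ((Subobject.isPullback f v).lift_snd _ _ _)
    rw [restrict_arrow]
    exact (Category.assoc _ _ _).symm.trans (congrArg (· ≫ f) (Subobject.ofLE_arrow _))
  · refine (ofHom p f).le_preimage v le_top (Subobject.pullbackπ f v) ?_
    rw [(Subobject.isPullback f v).w]
    exact ((Category.assoc _ _ _).symm.trans (congrArg (· ≫ f) (Subobject.ofLE_arrow _))).symm

/-- The composite of partial maps `f : x ⊇ u ⟶ y` and `g : y ⊇ v ⟶ z`, defined on `f⁻¹(v)`. -/
def comp {z : C} {q : PrimeFilter y} (f : PartialHom p y) (hf : ∀ v ∈ q.1, f.preimage v ∈ p.1)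
    (g : PartialHom q z) : PartialHom p z where
  dom := f.preimage g.dom
  mem := hf _ g.mem
  map := f.restrict g.dom ≫ g.map

/-- A criterion to identify the class of a composite. -/
lemma comp_rel {z : C} {q : PrimeFilter y} (f : PartialHom p y)
    (hf : ∀ v ∈ q.1, f.preimage v ∈ p.1) (g : PartialHom q z) (k : PartialHom p z)
    {w : Subobject x} (hw : w ∈ p.1) (hwf : w ≤ f.dom) (hwk : w ≤ k.dom)
    (t : (w : C) ⟶ (g.dom : C)) (ht : t ≫ g.dom.arrow = Subobject.ofLE w f.dom hwf ≫ f.map)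
    (h : t ≫ g.map = Subobject.ofLE w k.dom hwk ≫ k.map) : Rel (f.comp hf g) k := by
  have hle := f.le_preimage g.dom hwf t ht
  refine ⟨w, hw, hle, hwk, ?_⟩
  have ht' : Subobject.ofLE w _ hle ≫ f.restrict g.dom = t := by
    rw [← cancel_mono g.dom.arrow, Category.assoc, restrict_arrow,
      Subobject.ofLE_comp_ofLE_assoc, ht]
  change Subobject.ofLE w _ hle ≫ f.restrict g.dom ≫ g.map = _
  rw [← Category.assoc, ht', h]

lemma comp_rel_comp {z : C} {q : PrimeFilter y} {f f' : PartialHom p y}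
    (hf : ∀ v ∈ q.1, f.preimage v ∈ p.1) (hf' : ∀ v ∈ q.1, f'.preimage v ∈ p.1)
    {g g' : PartialHom q z} (hff : Rel f f') (hgg : Rel g g') :
    Rel (f.comp hf g) (f'.comp hf' g') := by
  obtain ⟨w, hw, a, b, e⟩ := hff
  obtain ⟨v, hv, c, d, e'⟩ := hgg
  have hle : w ⊓ f.preimage v ≤ f'.preimage v :=
    f'.le_preimage v (inf_le_left.trans b) (Subobject.ofLE _ _ inf_le_right ≫ f.restrict v) (by
      rw [Category.assoc, restrict_arrow, Subobject.ofLE_comp_ofLE_assoc,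
        ← Subobject.ofLE_comp_ofLE _ w _ inf_le_left b, Category.assoc, ← e,
        Subobject.ofLE_comp_ofLE_assoc])
  have key : Subobject.ofLE (w ⊓ f.preimage v) _ inf_le_right ≫ f.restrict v =
      Subobject.ofLE _ _ hle ≫ f'.restrict v := by
    rw [← cancel_mono v.arrow, Category.assoc, Category.assoc, restrict_arrow, restrict_arrow,
      Subobject.ofLE_comp_ofLE_assoc, Subobject.ofLE_comp_ofLE_assoc,
      ← Subobject.ofLE_comp_ofLE _ w _ inf_le_left a,
      ← Subobject.ofLE_comp_ofLE _ w _ inf_le_left b, Category.assoc, Category.assoc, e]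
  refine comp_rel f hf g (f'.comp hf' g') (Order.PFilter.inf_mem hw (hf v hv))
    (inf_le_left.trans a) (hle.trans (f'.preimage_mono d))
    (Subobject.ofLE _ _ inf_le_right ≫ f.restrict v ≫ Subobject.ofLE v _ c) ?_ ?_
  · simp only [Category.assoc, Subobject.ofLE_arrow, restrict_arrow,
      Subobject.ofLE_comp_ofLE_assoc]
  · have h2 : Subobject.ofLE _ _ (hle.trans (f'.preimage_mono d)) ≫ f'.restrict g'.dom =
        Subobject.ofLE _ _ hle ≫ f'.restrict v ≫ Subobject.ofLE v _ d := by
      rw [← cancel_mono g'.dom.arrow]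
      simp only [Category.assoc, Subobject.ofLE_arrow, restrict_arrow,
        Subobject.ofLE_comp_ofLE_assoc]
    have h3 : (Subobject.ofLE (w ⊓ f.preimage v) _ inf_le_right ≫ f.restrict v ≫
        Subobject.ofLE v _ c) ≫ g.map =
        (Subobject.ofLE _ _ hle ≫ f'.restrict v ≫ Subobject.ofLE v _ d) ≫ g'.map := by
      simp only [Category.assoc]
      rw [e', ← Category.assoc (Subobject.ofLE _ _ _) (f.restrict v), key, Category.assoc]
    exact h3.trans ((congrArg (· ≫ g'.map) h2.symm).trans (Category.assoc _ _ _))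

end PartialHom

variable [HasPullbacks C]

/-- A `p`-germ of maps `x ⟶ y`. -/
def Germ {x : C} (p : PrimeFilter x) (y : C) : Type (max u v) :=
  Quotient (PartialHom.setoid p y)

namespace Germ

variable {x y z t : C} {p : PrimeFilter x} {q : PrimeFilter y} {r : PrimeFilter z}

/-- The germ of a partial map. -/
def mk (f : PartialHom p y) : Germ p y := Quotient.mk _ f

/-- The germ of a morphism. -/
def ofHom (p : PrimeFilter x) (f : x ⟶ y) : Germ p y := mk (PartialHom.ofHom p f)

lemma mk_eq {f g : PartialHom p y} (h : PartialHom.Rel f g) : mk f = mk g := Quotient.sound h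

/-- `v` belongs to the pushforward `[f]_! p`, i.e. `f⁻¹(v)` belongs to `p`. -/
def PushMem (g : Germ p y) (v : Subobject y) : Prop :=
  Quotient.liftOn g (fun f => f.preimage v ∈ p.1) (fun _ _ h => propext
    ⟨PartialHom.preimage_mem_of_rel h,
      PartialHom.preimage_mem_of_rel ((PartialHom.setoid p y).iseqv.symm h)⟩)

/-- A `p`-germ `[f] : x ⟶ y` is `q`-continuous if `v ∈ q` implies `f⁻¹(v) ∈ p`,
i.e. `q ≤ [f]_! p`. -/
def Continuous (q : PrimeFilter y) (g : Germ p y) : Prop := ∀ v ∈ q.1, g.PushMem v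

lemma ofHom_pushMem (f : x ⟶ y) (v : Subobject y) :
    (ofHom p f).PushMem v ↔ (Subobject.pullback f).obj v ∈ p.1 := by
  change (PartialHom.ofHom p f).preimage v ∈ p.1 ↔ _
  rw [PartialHom.ofHom_preimage]

/-- Composition of germs, the first of which is continuous. -/
def comp (f : {f : Germ p y // Continuous q f}) (g : Germ q z) : Germ p z :=
  Quotient.hrecOn (motive := fun f₀ : Germ p y => Continuous q f₀ → Germ p z) f.1
    (fun f₀ hf => Quotient.liftOn g (fun g₀ => mk (f₀.comp hf g₀))
      (fun _ _ h => mk_eq (PartialHom.comp_rel_comp hf hf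
        ((PartialHom.setoid p y).iseqv.refl f₀) h)))
    (fun f₀ f₁ h => Function.hfunext (by rw [Quotient.sound h]) (by
      intro hf hf' _
      induction g using Quotient.inductionOn with
      | h g₀ => exact heq_of_eq (mk_eq (PartialHom.comp_rel_comp hf hf' h
          ((PartialHom.setoid q z).iseqv.refl g₀))))) f.2

lemma comp_mk (f : PartialHom p y) (hf : Continuous q (mk f)) (g : PartialHom q z) :
    comp ⟨mk f, hf⟩ (mk g) = mk (f.comp hf g) := rfl

lemma comp_continuous (f : {f : Germ p y // Continuous q f}) (g : Germ q z)
    (hg : Continuous r g) : Continuous r (comp f g) := by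
  obtain ⟨f, hf⟩ := f
  induction f using Quotient.inductionOn with | h f => ?_
  induction g using Quotient.inductionOn with | h g => ?_
  intro s hs
  have h1 : f.preimage (g.preimage s) ∈ p.1 := hf _ (hg s hs)
  refine Order.PFilter.mem_of_le (PartialHom.le_preimage (f.comp hf g) s
    (f.preimage_mono (g.preimage_le_dom s)) (f.restrict _ ≫ g.restrict s) ?_) h1
  have h2 : Subobject.ofLE _ _ (f.preimage_mono (g.preimage_le_dom s)) ≫ f.restrict g.dom =
      f.restrict (g.preimage s) ≫ Subobject.ofLE _ _ (g.preimage_le_dom s) := by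
    rw [← cancel_mono g.dom.arrow]
    simp only [Category.assoc, Subobject.ofLE_arrow, PartialHom.restrict_arrow,
      Subobject.ofLE_comp_ofLE_assoc]
  change _ = Subobject.ofLE _ _ _ ≫ f.restrict g.dom ≫ g.map
  rw [← Category.assoc (Subobject.ofLE _ _ _), h2]
  simp only [Category.assoc, PartialHom.restrict_arrow]

lemma comp_assoc (f : {f : Germ p y // Continuous q f}) (g : {g : Germ q z // Continuous r g})
    (k : Germ r t) : comp ⟨comp f g.1, comp_continuous f g.1 g.2⟩ k = comp f (comp g k) := by
  obtain ⟨f, hf⟩ := f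
  obtain ⟨g, hg⟩ := g
  induction f using Quotient.inductionOn with | h f => ?_
  induction g using Quotient.inductionOn with | h g => ?_
  induction k using Quotient.inductionOn with | h k => ?_
  have h2 : Subobject.ofLE _ _ (f.preimage_mono (g.preimage_le_dom k.dom)) ≫ f.restrict g.dom =
      f.restrict (g.preimage k.dom) ≫ Subobject.ofLE _ _ (g.preimage_le_dom k.dom) := by
    rw [← cancel_mono g.dom.arrow]
    simp only [Category.assoc, Subobject.ofLE_arrow, PartialHom.restrict_arrow,
      Subobject.ofLE_comp_ofLE_assoc]
  have hfg : Continuous r (mk (f.comp hf g)) := comp_continuous ⟨mk f, hf⟩ (mk g) hg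
  refine mk_eq (PartialHom.comp_rel (f.comp hf g) hfg k (f.comp hf (g.comp hg k))
    (hf _ (hg _ k.mem)) (f.preimage_mono (g.preimage_le_dom k.dom)) le_rfl
    (f.restrict (g.preimage k.dom) ≫ g.restrict k.dom) ?_ ?_)
  · change _ = Subobject.ofLE _ _ _ ≫ f.restrict g.dom ≫ g.map
    rw [← Category.assoc (Subobject.ofLE _ _ _), h2]
    simp only [Category.assoc, PartialHom.restrict_arrow]
  · exact (Category.assoc _ _ _).trans ((Category.id_comp _).symm.trans
      (congrArg (· ≫ _) (Subobject.ofLE_refl _).symm))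

lemma continuous_ofHom_id (p : PrimeFilter x) : Continuous p (ofHom p (𝟙 x)) := by
  intro v hv
  rw [ofHom_pushMem, Subobject.pullback_id]
  exact hv

lemma id_comp (g : Germ p y) : comp ⟨ofHom p (𝟙 x), continuous_ofHom_id p⟩ g = g := by
  induction g using Quotient.inductionOn with | h g => ?_
  refine mk_eq (PartialHom.comp_rel _ (continuous_ofHom_id p) g g g.mem le_top le_rfl (𝟙 _) ?_ ?_)
  · simp [PartialHom.ofHom]
  · simp

/-- Postcomposition of a germ with a morphism. -/
def postcomp (g : Germ p y) (f : y ⟶ z) : Germ p z :=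
  Quotient.liftOn g (fun g₀ => mk ⟨g₀.dom, g₀.mem, g₀.map ≫ f⟩) (by
    rintro a b ⟨w, hw, ha, hb, h⟩
    exact mk_eq ⟨w, hw, ha, hb, by simp only [← Category.assoc, h]⟩)

lemma comp_postcomp (f : {f : Germ p y // Continuous q f}) (g : Germ q z) (h : z ⟶ t) :
    (comp f g).postcomp h = comp f (g.postcomp h) := by
  obtain ⟨f, hf⟩ := f
  induction f using Quotient.inductionOn with | h f => ?_
  induction g using Quotient.inductionOn with | h g => ?_
  exact mk_eq ⟨f.preimage g.dom, hf _ g.mem, le_rfl, le_rfl, by simp [PartialHom.comp]⟩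

lemma postcomp_id (g : Germ p y) : g.postcomp (𝟙 y) = g := by
  induction g using Quotient.inductionOn with | h g => ?_
  exact mk_eq ⟨g.dom, g.mem, le_rfl, le_rfl, by simp⟩

lemma postcomp_postcomp (g : Germ p y) (f : y ⟶ z) (h : z ⟶ t) :
    g.postcomp (f ≫ h) = (g.postcomp f).postcomp h := by
  induction g using Quotient.inductionOn with | h g => ?_
  exact mk_eq ⟨g.dom, g.mem, le_rfl, le_rfl, by simp⟩

lemma comp_ofHom (f : {f : Germ p y // Continuous q f}) (g : y ⟶ z) :
    comp f (ofHom q g) = f.1.postcomp g := by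
  obtain ⟨f, hf⟩ := f
  induction f using Quotient.inductionOn with | h f => ?_
  let i : y ⟶ ((⊤ : Subobject y) : C) := inv (⊤ : Subobject y).arrow
  have hi : i ≫ (⊤ : Subobject y).arrow = 𝟙 y := IsIso.inv_hom_id _
  have h1 : (f.map ≫ i) ≫ (⊤ : Subobject y).arrow = Subobject.ofLE f.dom _ le_rfl ≫ f.map := by
    rw [Category.assoc, hi, Category.comp_id, Subobject.ofLE_refl, Category.id_comp]
  refine mk_eq (PartialHom.comp_rel f hf (PartialHom.ofHom q g) ⟨f.dom, f.mem, f.map ≫ g⟩ f.mem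
    le_rfl le_rfl (f.map ≫ i) h1 ?_)
  exact (Category.assoc _ _ _).symm.trans ((congrArg (· ≫ g) h1).trans (Category.assoc _ _ _))

end Germ

variable (C) in
/-- The objects of the category of prime filters: pairs `(x, p)`, with `p` a prime filter on the
subobjects of `x`. -/
structure Spec : Type (max u v) where
  pt : C
  filter : PrimeFilter pt

/-- Morphisms `(x, p) ⟶ (y, q)` are `q`-continuous `p`-germs of maps `x ⟶ y`. -/
instance : Category.{max u v} (Spec C) where
  Hom a b := {g : Germ a.filter b.pt // Germ.Continuous b.filter g}
  id a := ⟨Germ.ofHom a.filter (𝟙 a.pt), Germ.continuous_ofHom_id a.filter⟩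
  comp f g := ⟨Germ.comp f g.1, Germ.comp_continuous f g.1 g.2⟩
  id_comp f := Subtype.ext (Germ.id_comp f.1)
  comp_id f := Subtype.ext ((Germ.comp_ofHom f _).trans (Germ.postcomp_id f.1))
  assoc f g h := Subtype.ext (Germ.comp_assoc f g h.1)

/-- The morphism `[f] : (x, p) ⟶ (y, q)` given by a morphism `f : x ⟶ y` such that `v ∈ q` implies
`f⁻¹(v) ∈ p`, i.e. `f_! p ≥ q`. -/
def Spec.homOf {x y : C} {p : PrimeFilter x} {q : PrimeFilter y} (f : x ⟶ y)
    (h : ∀ v ∈ q.1, (Subobject.pullback f).obj v ∈ p.1) : Spec.mk x p ⟶ Spec.mk y q :=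
  ⟨Germ.ofHom p f, fun v hv => (Germ.ofHom_pushMem f v).2 (h v hv)⟩

/-- The morphism `[id] : (x, p) ⟶ (x, q)` for `q ≤ p`. -/
def Spec.idOfLE {x : C} {p q : PrimeFilter x} (h : q ≤ p) : Spec.mk x p ⟶ Spec.mk x q :=
  Spec.homOf (𝟙 x) (fun v hv => by rw [Subobject.pullback_id]; exact h hv)

lemma Spec.idOfLE_refl {x : C} (p : PrimeFilter x) :
    Spec.idOfLE (le_refl p) = 𝟙 (Spec.mk x p) := rfl

lemma Spec.idOfLE_comp {x : C} {p q r : PrimeFilter x} (h : q ≤ p) (h' : r ≤ q) :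
    Spec.idOfLE h ≫ Spec.idOfLE h' = Spec.idOfLE (h'.trans h) :=
  Subtype.ext ((Germ.comp_ofHom (q := q) (Spec.idOfLE h) (𝟙 x)).trans (Germ.postcomp_id _))

/-- The presheaf `Spec(C)(-, y)` on the category of prime filters, taking `(x, p)` to the set of
`p`-germs of maps `x ⟶ y`. -/
def germPresheaf (y : C) : (Spec C)ᵒᵖ ⥤ Type (max u v) where
  obj a := Germ a.unop.filter y
  map f := TypeCat.ofHom (fun g => Germ.comp f.unop g)
  map_id a := by
    ext g
    exact Germ.id_comp g
  map_comp f f' := by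
    ext g
    exact Germ.comp_assoc f'.unop f.unop g

variable (C) in
/-- The functor `y ↦ Spec(C)(-, y)`, acting on morphisms by postcomposition. -/
def germFunctor : C ⥤ (Spec C)ᵒᵖ ⥤ Type (max u v) where
  obj y := germPresheaf y
  map f :=
    { app := fun _ => TypeCat.ofHom (fun g => Germ.postcomp g f)
      naturality := fun _ _ k => by
        ext g
        exact Germ.comp_postcomp k.unop g f }
  map_id y := by
    ext a g
    exact Germ.postcomp_id g
  map_comp f f' := by
    ext a g
    exact Germ.postcomp_postcomp g f f'

/-! ### The topology -/

/-- The family of all `[f] : (x, p) ⟶ (y, q)`, where `p` runs over the prime filters on `x` with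
`f_! p ≥ q`. -/
def coveringFamily {x : C} (a : Spec C) (f : x ⟶ a.pt) : Presieve a :=
  Presieve.ofArrows
    (fun p : {p : PrimeFilter x // ∀ v ∈ a.filter.1, (Subobject.pullback f).obj v ∈ p.1} =>
      Spec.mk x p.1)
    (fun p => Spec.homOf f p.2)

variable (C) in
/-- The families `coveringFamily a f`, for `f` an effective epimorphism. -/
def effectiveEpiFamilies : Precoverage (Spec C) where
  coverings a := {R | ∃ (x : C) (f : x ⟶ a.pt), EffectiveEpi f ∧ R = coveringFamily a f}

variable (C) in
/-- The Grothendieck topology generated by these families. -/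
def topology : GrothendieckTopology (Spec C) := (effectiveEpiFamilies C).toGrothendieck

end Spec

/-! ### The comparison functor and the extension property -/

section Main

variable (C : Type u) [SmallCategory C] [HasPullbacks C]

/-- The topos of sheaves of sets on the category of prime filters. -/
abbrev SpecTopos := Sheaf (topology C) (Type u)

/-- The functor `φ` taking `y` to the sheafification of `Spec(C)(-, y)`. -/
def phi : C ⥤ SpecTopos C := germFunctor C ⋙ presheafToSheaf (topology C) (Type u)

/-- The functor taking `(x, p)` to the sheafified representable `#Y(x, p)`. -/
def sheafYoneda : Spec C ⥤ SpecTopos C := yoneda ⋙ presheafToSheaf (topology C) (Type u)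

variable {C}

/-- The diagram `(x, p₀) ⟵ (x, p₁) ⟵ …` given by an increasing family of prime filters on `x`. -/
def chainDiagram {x : C} {ι : Type u} [LinearOrder ι] (p : ι →o PrimeFilter x) :
    ιᵒᵖ ⥤ Spec C where
  obj i := Spec.mk x (p i.unop)
  map f := Spec.idOfLE (p.monotone f.unop.le)
  map_id _ := Spec.idOfLE_refl _
  map_comp f g := (Spec.idOfLE_comp (p.monotone f.unop.le) (p.monotone g.unop.le)).symm

/-- The cone `(x, p_∞) ⟶ (x, p_i)` on such a diagram, for a prime filter `p_∞` that contains all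
the `p_i`. -/
def chainCone {x : C} {ι : Type u} [LinearOrder ι] (p : ι →o PrimeFilter x) (pinf : PrimeFilter x)
    (h : ∀ i, p i ≤ pinf) : Cone (chainDiagram p) where
  pt := Spec.mk x pinf
  π :=
    { app := fun i => Spec.idOfLE (h i.unop)
      naturality := fun i _ f =>
        (Category.id_comp _).trans
          (Spec.idOfLE_comp (h i.unop) (p.monotone f.unop.le)).symm }

variable (C) in
/-- `Fun^*_{p_∞}(Sh(Spec C), E)`: the functors that preserve finite limits and small colimits, and
that, for every chain of prime filters on an object `x`, indexed by a well-ordered set, with union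
the prime filter `pinf`, take the cone formed by the sheafified representables `#Y(x, pinf)` and
`#Y(x, p i)` to a limit cone. (As filters are nonempty, a chain with union `pinf` is nonempty.) -/
structure IsPInfLexCocontinuous {E : Type u₁} [Category.{v₁} E] (M : SpecTopos C ⥤ E) :
    Prop where
  lex : PreservesFiniteLimits M
  cocontinuous : PreservesColimitsOfSize.{u, u} M
  chain : ∀ {x : C} {ι : Type u} [LinearOrder ι] [WellFoundedLT ι] (p : ι →o PrimeFilter x)
    (pinf : PrimeFilter x) (h : ∀ i, p i ≤ pinf),
    (∀ u, u ∈ pinf.1 ↔ ∃ i, u ∈ (p i).1) →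
      Nonempty (IsLimit ((sheafYoneda C ⋙ M).mapCone (chainCone p pinf h)))

variable (C) in
/-- The property defining the full subcategory `Fun^*_{p_∞}(Sh(Spec C), E)`. -/
def pInfLexCocontinuousFunctors (E : Type u₁) [Category.{v₁} E] :
    ObjectProperty (SpecTopos C ⥤ E) :=
  fun M => IsPInfLexCocontinuous C M

variable (C) in
/-- Precomposition with `φ`, as a functor `Fun^*_{p_∞}(Sh(Spec C), E) ⥤ Fun(C, E)`. -/
def precompPhi (E : Type u₁) [Category.{v₁} E] :
    (pInfLexCocontinuousFunctors C E).FullSubcategory ⥤ (C ⥤ E) :=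
  (pInfLexCocontinuousFunctors C E).ι ⋙ (Functor.whiskeringLeft C (SpecTopos C) E).obj (phi C)

end Main

end PrimeSpec

end

/-!
The proof rests on one property of a functor `M` on the topos of prime filters
(`PreservesFilterInter`): `M(#Y(x, p))` is the intersection, in `M(φ x)`, of the `M(φ w)` for
`w ∈ p`. In the topos itself, `φ x` is the union of the `#Y(x, p)`, since every germ factors through
the image of the prime filter on which it is defined, and the topos is generated by these objects.
So if `M` is cocontinuous and `M'` has the property, a natural transformation `φ ⋙ M ⟶ φ ⋙ M'`
restricts to the `#Y(x, p)` and extends uniquely to `M ⟶ M'`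
(`PreservesFilterInter.exists_natTrans`, `natTrans_ext_of_whiskerLeft_phi`).

The property implies the chain condition, as the union of a chain of filters has no other members
than those of the filters in the chain. Conversely, assume the chain condition, in a topos generated
by primes. A prime `A ⟶ M(φ x)` is contained in some `M(#Y(x, q))`, and by the chain condition and
Zorn's lemma there is a maximal such `q`. The intersection of `#Y(x, q)` and `φ w` is the union of
the `#Y(x, r)` with `q ≤ r` and `w ∈ r`, so by maximality `q` contains every `w` such that `A` is
contained in `M(φ w)` (`IsPInfLexCocontinuous.preservesFilterInter`). Zorn's lemma needs arbitrary
chains of filters, but these have well-ordered cofinal subsets.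

That `φ`, followed by any `M` that preserves finite limits and small colimits, is coherent follows
from local surjectivity statements about germs (`isCoherentFunctor_phi_comp`).

It remains to extend a coherent functor `F` to a topos of sheaves generated by primes. Its elements
`h : A ⟶ F x` with `A` in a small covering family of primes form a category `Elem A F`, with a
topology for which the topos is the category of sheaves on it. A prime element `h` has a prime
filter, that of all `w` such that `h` factors through `F w` (`factorFilter`). This defines a functor
from `Elem A F` to the category of prime filters (`Elem.toSpec`), which is cocontinuous because `F`
preserves effective epimorphisms (`Elem.isCocontinuous_toSpec`), and so induces an inverse image
functor on sheaves. The germs at the filter of `h` of maps to `y` can be evaluated at `h`, giving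
morphisms `A ⟶ F y`; evaluation is injective, and locally surjective since `h` can be replaced by a
pair of elements. Hence the inverse image of `φ y` is `F y` (`Elem.phiCompInverseImageIso`). The
inverse image functor preserves intersections over filters, as a germ `[id] : (x, p') ⟶ (x, p)`
exists whenever `p ≤ p'` (`Elem.preservesFilterInter_inverseImage`).
-/

noncomputable section

namespace PrimeSpec

/-! ### Prime filters and their images under germs -/

section PrimeFilters

variable {C : Type u} [Category.{v} C]

namespace PrimeFilter

lemma not_mem_of_isBot {x : C} (p : PrimeFilter x) {w : Subobject x} (hw : IsBot w) :
    w ∉ p.1 := by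
  obtain ⟨z, hz⟩ := p.2.compl_ideal.Nonempty
  exact fun h => hz (p.1.mem_of_le (hw z) h)

lemma mem_or_mem {x : C} (p : PrimeFilter x) {a b w : Subobject x} (hw : IsLUB {a, b} w)
    (h : w ∈ p.1) : a ∈ p.1 ∨ b ∈ p.1 := by
  by_contra! hab
  obtain ⟨c, hc, hac, hbc⟩ := p.2.compl_ideal.Directed a hab.1 b hab.2
  refine hc (p.1.mem_of_le (hw.2 ?_) h)
  rintro _ (rfl | rfl) <;> assumption

/-- A set of subobjects that is upward closed, closed under finite meets, and whose complement is
closed under finite joins, as a prime filter. -/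
def ofSet [HasPullbacks C] {x : C} (s : Set (Subobject x)) (top : ⊤ ∈ s)
    (upper : ∀ {a b}, a ≤ b → a ∈ s → b ∈ s) (inf : ∀ {a b}, a ∈ s → b ∈ s → a ⊓ b ∈ s)
    (bot : ∃ w, w ∉ s)
    (lub : ∀ a b, ∃ w, a ≤ w ∧ b ≤ w ∧ (w ∈ s → a ∈ s ∨ b ∈ s)) : PrimeFilter x :=
  ⟨(Order.IsPFilter.of_def (F := s) ⟨_, top⟩
      (fun a ha b hb => ⟨a ⊓ b, inf ha hb, inf_le_left, inf_le_right⟩) upper).toPFilter,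
    { compl_ideal :=
        { IsLowerSet := fun _ _ hba ha hb => ha (upper hba hb)
          Nonempty := bot
          Directed := fun a ha b hb => by
            obtain ⟨w, haw, hbw, h⟩ := lub a b
            exact ⟨w, fun hw => (h hw).elim ha hb, haw, hbw⟩ } }⟩

end PrimeFilter

end PrimeFilters

section Germs

variable {C : Type u} [Category.{v} C]

namespace PartialHom

variable [HasPullbacks C] {x y : C} {p : PrimeFilter x}

lemma preimage_eq (f : PartialHom p y) (w : Subobject y) :
    f.preimage w = (Subobject.map f.dom.arrow).obj ((Subobject.pullback f.map).obj w) := by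
  conv_rhs => rw [← Subobject.mk_arrow ((Subobject.pullback f.map).obj w), Subobject.map_mk]
  rfl

lemma le_preimage_of_factors (f : PartialHom p y) (w : Subobject y) {t : Subobject x}
    (ht : t ≤ f.dom) (h : w.Factors (Subobject.ofLE t f.dom ht ≫ f.map)) : t ≤ f.preimage w :=
  f.le_preimage w ht (w.factorThru _ h) (Subobject.factorThru_arrow _ _ _)

lemma isBot_preimage [CoherentCategory C] (f : PartialHom p y) {w : Subobject y} (hw : IsBot w) :
    IsBot (f.preimage w) := by
  intro z
  rw [preimage_eq]
  exact ((Subobject.mapPullbackAdj f.dom.arrow).gc _ _).2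
    (CoherentCategory.isBot_pullback f.map w hw _)

lemma isLUB_preimage [CoherentCategory C] (f : PartialHom p y) {a b w : Subobject y}
    (hw : IsLUB {a, b} w) : IsLUB {f.preimage a, f.preimage b} (f.preimage w) := by
  have := (Subobject.mapPullbackAdj f.dom.arrow).gc.isLUB_l_image
    (CoherentCategory.isLUB_pullback f.map a b w hw)
  simpa only [Set.image_pair, ← preimage_eq] using this

end PartialHom

namespace Germ

variable [HasPullbacks C] {x y z t : C} {p : PrimeFilter x}

lemma ind {P : Germ p y → Prop} (h : ∀ f, P (mk f)) (g : Germ p y) : P g :=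
  Quotient.ind h g

lemma mk_eq_iff {f g : PartialHom p y} : mk f = mk g ↔ PartialHom.Rel f g :=
  ⟨fun h => Quotient.exact h, mk_eq⟩

lemma postcomp_mk (f : PartialHom p y) (k : y ⟶ z) :
    (mk f).postcomp k = mk ⟨f.dom, f.mem, f.map ≫ k⟩ := rfl

lemma ofHom_postcomp (f : x ⟶ y) (k : y ⟶ z) :
    (ofHom p f).postcomp k = ofHom p (f ≫ k) :=
  mk_eq ⟨⊤, Order.PFilter.top_mem, le_rfl, le_rfl, by simp [PartialHom.ofHom]⟩

/-- `v` belongs to the image of `p` under a germ exactly when the germ takes values in `v`. -/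
lemma pushMem_iff_exists (g : Germ p y) (w : Subobject y) :
    g.PushMem w ↔ ∃ t : Germ p (w : C), t.postcomp w.arrow = g := by
  constructor
  · induction g using ind with | h f => ?_
    intro h
    exact ⟨mk ⟨f.preimage w, h, f.restrict w⟩,
      mk_eq ⟨f.preimage w, h, le_rfl, f.preimage_le_dom w, by simp [f.restrict_arrow]⟩⟩
  · rintro ⟨t, rfl⟩
    induction t using ind with | h t => ?_
    exact p.1.mem_of_le (PartialHom.le_preimage _ w le_rfl t.map (by simp)) t.mem

lemma postcomp_injective (f : y ⟶ z) [Mono f] :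
    Function.Injective (fun g : Germ p y => g.postcomp f) := by
  intro a b h
  induction a using ind with | h a => ?_
  induction b using ind with | h b => ?_
  obtain ⟨w, hw, ha, hb, e⟩ := mk_eq_iff.1 h
  exact mk_eq ⟨w, hw, ha, hb, (cancel_mono f).1 (by simpa using e)⟩

lemma pushMem_mono (g : Germ p y) {a b : Subobject y} (h : a ≤ b) (ha : g.PushMem a) :
    g.PushMem b := by
  induction g using ind with | h f => ?_
  exact p.1.mem_of_le (f.preimage_mono h) ha

lemma pushMem_postcomp (g : Germ p y) (f : y ⟶ z) (w : Subobject z) :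
    (g.postcomp f).PushMem w ↔ g.PushMem ((Subobject.pullback f).obj w) := by
  induction g using ind with | h g => ?_
  change PartialHom.preimage _ _ ∈ _ ↔ PartialHom.preimage _ _ ∈ _
  rw [PartialHom.preimage_eq, PartialHom.preimage_eq, Subobject.pullback_comp]

/-- The image `g_! p` of a prime filter `p` under a `p`-germ `g`. -/
def pushforward [CoherentCategory C] (g : Germ p y) : PrimeFilter y :=
  PrimeFilter.ofSet {w | g.PushMem w}
    (by
      induction g using ind with | h f => ?_
      exact p.1.mem_of_le (f.le_preimage_of_factors ⊤ le_rfl (Subobject.top_factors _)) f.mem)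
    (fun hab ha => g.pushMem_mono hab ha)
    (by
      induction g using ind with | h f => ?_
      intro a b ha hb
      refine p.1.mem_of_le (x := f.preimage a ⊓ f.preimage b) ?_ (Order.PFilter.inf_mem ha hb)
      refine f.le_preimage_of_factors _ (inf_le_left.trans (f.preimage_le_dom a)) ?_
      rw [Subobject.inf_factors]
      constructor
      · rw [← Subobject.ofLE_comp_ofLE _ _ _ inf_le_left (f.preimage_le_dom a), Category.assoc,
          ← f.restrict_arrow, ← Category.assoc]
        exact Subobject.factors_comp_arrow _
      · rw [← Subobject.ofLE_comp_ofLE _ _ _ inf_le_right (f.preimage_le_dom b), Category.assoc,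
          ← f.restrict_arrow, ← Category.assoc]
        exact Subobject.factors_comp_arrow _)
    (by
      induction g using ind with | h f => ?_
      obtain ⟨w, hw⟩ := CoherentCategory.exists_isBot y
      exact ⟨w, p.not_mem_of_isBot (f.isBot_preimage hw)⟩)
    (by
      induction g using ind with | h f => ?_
      intro a b
      obtain ⟨w, hw⟩ := CoherentCategory.exists_isLUB a b
      exact ⟨w, hw.1 (by simp), hw.1 (by simp), p.mem_or_mem (f.isLUB_preimage hw)⟩)

/-- A germ with values in a least subobject does not exist. -/
lemma isEmpty_of_isBot [CoherentCategory C] {w : Subobject y} (hw : IsBot w) :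
    IsEmpty (Germ p (w : C)) :=
  ⟨fun g => (g.postcomp w.arrow).pushforward.not_mem_of_isBot hw
    ((pushMem_iff_exists _ _).2 ⟨g, rfl⟩)⟩

/-- A germ with values in a binary union takes values in one of the two subobjects. -/
lemma exists_postcomp_of_isLUB [CoherentCategory C] {a b w : Subobject y} (hw : IsLUB {a, b} w)
    (ha : a ≤ w) (hb : b ≤ w) (g : Germ p (w : C)) :
    (∃ s : Germ p (a : C), s.postcomp (Subobject.ofLE a w ha) = g) ∨
      ∃ s : Germ p (b : C), s.postcomp (Subobject.ofLE b w hb) = g := by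
  have key (c : Subobject y) (hc : c ≤ w) (h : (g.postcomp w.arrow).PushMem c) :
      ∃ s : Germ p (c : C), s.postcomp (Subobject.ofLE c w hc) = g := by
    obtain ⟨s, hs⟩ := (pushMem_iff_exists _ _).1 h
    refine ⟨s, postcomp_injective w.arrow ?_⟩
    simpa [← postcomp_postcomp] using hs
  exact ((g.postcomp w.arrow).pushforward.mem_or_mem hw
    ((pushMem_iff_exists _ _).2 ⟨g, rfl⟩)).imp (key a ha) (key b hb)

/-- A pair of germs that agree after composition is a germ with values in the pullback. -/
lemma exists_of_isPullback {P X Y Z : C} {fst : P ⟶ X} {snd : P ⟶ Y} {f : X ⟶ Z} {g : Y ⟶ Z}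
    (h : IsPullback fst snd f g) (a : Germ p X) (b : Germ p Y)
    (hab : a.postcomp f = b.postcomp g) :
    ∃ c : Germ p P, c.postcomp fst = a ∧ c.postcomp snd = b := by
  induction a using ind with | h a => ?_
  induction b using ind with | h b => ?_
  obtain ⟨w, hw, ha, hb, e⟩ := mk_eq_iff.1 hab
  refine ⟨mk ⟨w, hw, h.lift (Subobject.ofLE w _ ha ≫ a.map) (Subobject.ofLE w _ hb ≫ b.map)
    (by simpa using e)⟩, mk_eq ⟨w, hw, le_rfl, ha, by simp⟩, mk_eq ⟨w, hw, le_rfl, hb, by simp⟩⟩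

lemma eq_of_isPullback {P X Y Z : C} {fst : P ⟶ X} {snd : P ⟶ Y} {f : X ⟶ Z} {g : Y ⟶ Z}
    (h : IsPullback fst snd f g) {a b : Germ p P} (h₁ : a.postcomp fst = b.postcomp fst)
    (h₂ : a.postcomp snd = b.postcomp snd) : a = b := by
  induction a using ind with | h a => ?_
  induction b using ind with | h b => ?_
  obtain ⟨w, hw, ha, hb, e⟩ := mk_eq_iff.1 h₁
  obtain ⟨w', hw', ha', hb', e'⟩ := mk_eq_iff.1 h₂
  refine mk_eq ⟨w ⊓ w', Order.PFilter.inf_mem hw hw', inf_le_left.trans ha,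
    inf_le_left.trans hb, h.hom_ext ?_ ?_⟩
  · rw [← Subobject.ofLE_comp_ofLE _ _ _ inf_le_left ha,
      ← Subobject.ofLE_comp_ofLE _ _ _ inf_le_left hb]
    simpa using congrArg (Subobject.ofLE _ _ inf_le_left ≫ ·) e
  · rw [← Subobject.ofLE_comp_ofLE _ _ _ inf_le_right ha',
      ← Subobject.ofLE_comp_ofLE _ _ _ inf_le_right hb']
    simpa using congrArg (Subobject.ofLE _ _ inf_le_right ≫ ·) e'

lemma eq_of_isTerminal {T : C} (hT : IsTerminal T) (a b : Germ p T) : a = b := by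
  induction a using ind with | h a => ?_
  induction b using ind with | h b => ?_
  exact mk_eq ⟨a.dom ⊓ b.dom, Order.PFilter.inf_mem a.mem b.mem, inf_le_left, inf_le_right,
    hT.hom_ext _ _⟩

end Germ

end Germs

/-! ### The presheaves of germs -/

section Presheaves

variable {C : Type u} [Category.{v} C]

lemma isPullback_germFunctor_map [HasPullbacks C] {P X Y Z : C} {fst : P ⟶ X} {snd : P ⟶ Y}
    {f : X ⟶ Z} {g : Y ⟶ Z} (h : IsPullback fst snd f g) (a : (Spec C)ᵒᵖ) :
    IsPullback ((germFunctor C ⋙ (evaluation (Spec C)ᵒᵖ (Type (max u v))).obj a).map fst)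
      ((germFunctor C ⋙ (evaluation (Spec C)ᵒᵖ (Type (max u v))).obj a).map snd)
      ((germFunctor C ⋙ (evaluation (Spec C)ᵒᵖ (Type (max u v))).obj a).map f)
      ((germFunctor C ⋙ (evaluation (Spec C)ᵒᵖ (Type (max u v))).obj a).map g) := by
  refine (Types.isPullback_iff _ _ _ _).2 ⟨?_, ?_, ?_⟩
  · rw [← Functor.map_comp, ← Functor.map_comp, h.w]
  · exact fun x₁ y₁ e => Germ.eq_of_isPullback h e.1 e.2
  · exact fun x₂ x₃ e => Germ.exists_of_isPullback h x₂ x₃ e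

instance preservesFiniteLimits_germFunctor [HasFiniteLimits C] :
    PreservesFiniteLimits (germFunctor C) := by
  refine preservesFiniteLimits_of_evaluation _ fun a => ?_
  have : PreservesLimit (Functor.empty.{0} C)
      (germFunctor C ⋙ (evaluation (Spec C)ᵒᵖ (Type (max u v))).obj a) := by
    refine preservesLimit_of_preserves_limit_cone terminalIsTerminal
      ((isLimitMapConeEmptyConeEquiv _ _).2 ?_)
    exact (Types.isTerminalEquivUnique (Germ a.unop.filter (⊤_ C))).symm
      ⟨⟨Germ.ofHom _ (terminal.from _)⟩, fun b => Germ.eq_of_isTerminal terminalIsTerminal _ _⟩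
  have : PreservesLimitsOfShape (Discrete PEmpty.{1})
      (germFunctor C ⋙ (evaluation (Spec C)ᵒᵖ (Type (max u v))).obj a) :=
    preservesLimitsOfShape_pempty_of_preservesTerminal _
  have : PreservesLimitsOfShape WalkingCospan
      (germFunctor C ⋙ (evaluation (Spec C)ᵒᵖ (Type (max u v))).obj a) := by
    refine ⟨fun {K} => ?_⟩
    have (K : WalkingCospan ⥤ C) : PreservesLimit (cospan (K.map WalkingCospan.Hom.inl)
        (K.map WalkingCospan.Hom.inr))
        (germFunctor C ⋙ (evaluation (Spec C)ᵒᵖ (Type (max u v))).obj a) := by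
      have hP := IsPullback.of_hasPullback (K.map WalkingCospan.Hom.inl)
        (K.map WalkingCospan.Hom.inr)
      exact preservesLimit_of_preserves_limit_cone hP.isLimit
        ((isLimitMapConePullbackConeEquiv _ hP.w).2 (isPullback_germFunctor_map hP a).isLimit)
    exact preservesLimit_of_iso_diagram _ (diagramIsoCospan K).symm
  exact preservesFiniteLimits_of_preservesTerminal_and_pullbacks _

end Presheaves

/-! ### Jointly locally surjective families -/

section JointlySurjective

variable {D : Type u₁} [Category.{v₁} D] (J : GrothendieckTopology D)

/-- The sieve of all restrictions of a section `s` that lift along a member of a family `m` of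
morphisms of presheaves. -/
def jointImageSieve {ι : Type*} {U : ι → Dᵒᵖ ⥤ Type u} {X : Dᵒᵖ ⥤ Type u} (m : ∀ i, U i ⟶ X)
    {d : D} (s : X.obj (op d)) : Sieve d where
  arrows e f := ∃ i, ∃ t : (U i).obj (op e), (m i).app _ t = X.map f.op s
  downward_closed := by
    rintro e e' f ⟨i, t, ht⟩ g
    exact ⟨i, (U i).map g.op t, by rw [NatTrans.naturality_apply, ht, op_comp,
      Functor.map_comp_apply]⟩

/-- A family of morphisms of presheaves is jointly locally surjective if every section of the
target lifts, locally, along some member of the family. -/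
def JointlyLocallySurjective {ι : Type*} {U : ι → Dᵒᵖ ⥤ Type u} {X : Dᵒᵖ ⥤ Type u}
    (m : ∀ i, U i ⟶ X) : Prop :=
  ∀ ⦃d : D⦄ (s : X.obj (op d)), jointImageSieve m s ∈ J d

variable {J}

lemma JointlyLocallySurjective.of_forall_exists {ι : Type*} {U : ι → Dᵒᵖ ⥤ Type u}
    {X : Dᵒᵖ ⥤ Type u} {m : ∀ i, U i ⟶ X}
    (h : ∀ d (s : X.obj (op d)), ∃ i, ∃ t : (U i).obj (op d), (m i).app _ t = s) :
    JointlyLocallySurjective J m := by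
  intro d s
  convert! J.top_mem d
  exact Sieve.ext fun e f => ⟨fun _ => trivial, fun _ => h e _⟩

lemma JointlyLocallySurjective.hom_ext {ι : Type*} {U : ι → Dᵒᵖ ⥤ Type u} {X : Dᵒᵖ ⥤ Type u}
    {m : ∀ i, U i ⟶ X} (hm : JointlyLocallySurjective J m) {Z : Dᵒᵖ ⥤ Type u}
    (hZ : Presheaf.IsSheaf J Z) {f g : X ⟶ Z} (h : ∀ i, m i ≫ f = m i ≫ g) : f = g := by
  ext d s
  refine (((isSheaf_iff_isSheaf_of_type _ _).1 hZ).isSeparated _ (hm s)).ext ?_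
  rintro e k ⟨i, t, ht⟩
  change Z.map k.op (f.app d s) = Z.map k.op (g.app d s)
  rw [← NatTrans.naturality_apply, ← NatTrans.naturality_apply, ← ht]
  exact ConcreteCategory.congr_hom (NatTrans.congr_app (h i) _) t

/-- A family of morphisms into `X` is jointly extremal if a monomorphism through which every member
factors is invertible. -/
def JointlyExtremal {E : Type*} [Category* E] {ι : Type*} {U : ι → E} {X : E}
    (m : ∀ i, U i ⟶ X) : Prop :=
  ∀ ⦃A : E⦄ (j : A ⟶ X) [Mono j], (∀ i, ∃ l, l ≫ j = m i) → IsIso j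

lemma isRegularEpi_map_of_preservesColimits {A B : Type*} [Category* A] [Category* B]
    (M : A ⥤ B) [PreservesColimitsOfShape WalkingParallelPair M] {X Y : A} (f : X ⟶ Y)
    [hf : IsRegularEpi f] : IsRegularEpi (M.map f) := by
  obtain ⟨⟨h⟩⟩ := hf
  exact ⟨⟨{ W := M.obj h.W
            left := M.map h.left
            right := M.map h.right
            w := by rw [← M.map_comp, ← M.map_comp, h.w]
            isColimit := isColimitCoforkMapOfIsColimit M h.w h.isColimit }⟩⟩

instance hasColimitsOfSize_sheaf {D : Type u} [SmallCategory D] (J : GrothendieckTopology D) :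
    HasColimitsOfSize.{u, u} (Sheaf J (Type u)) :=
  haveI : HasColimitsOfSize.{u, u} (Type u) := inferInstance
  Sheaf.instHasColimitsOfSize

lemma JointlyLocallySurjective.sheafify_hom_ext {D : Type u} [SmallCategory D]
    {J : GrothendieckTopology D} {ι : Type*} {U : ι → Dᵒᵖ ⥤ Type u} {X : Dᵒᵖ ⥤ Type u}
    {m : ∀ i, U i ⟶ X} (hm : JointlyLocallySurjective J m) {Z : Sheaf J (Type u)}
    {f g : (presheafToSheaf J (Type u)).obj X ⟶ Z}
    (h : ∀ i, (presheafToSheaf J (Type u)).map (m i) ≫ f =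
      (presheafToSheaf J (Type u)).map (m i) ≫ g) : f = g := by
  refine ((sheafificationAdjunction J (Type u)).homEquiv _ _).injective
    (hm.hom_ext Z.property fun i => ?_)
  exact ((sheafificationAdjunction J (Type u)).homEquiv_naturality_left _ _).symm.trans
    ((congrArg _ (h i)).trans ((sheafificationAdjunction J (Type u)).homEquiv_naturality_left _ _))

/-- A cocontinuous functor on sheaves takes jointly locally surjective families to jointly extremal
families. -/
lemma JointlyLocallySurjective.jointlyExtremal {D : Type u} [SmallCategory D]
    {J : GrothendieckTopology D} {E : Type*} [Category* E]
    (M : Sheaf J (Type u) ⥤ E) [PreservesColimitsOfSize.{u, u} M]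
    {ι : Type u} {U : ι → Dᵒᵖ ⥤ Type u} {X : Dᵒᵖ ⥤ Type u} {m : ∀ i, U i ⟶ X}
    (hm : JointlyLocallySurjective J m) :
    JointlyExtremal (U := fun i => M.obj ((presheafToSheaf J (Type u)).obj (U i)))
      (X := M.obj ((presheafToSheaf J (Type u)).obj X))
      fun i => M.map ((presheafToSheaf J (Type u)).map (m i)) := by
  intro A j _ hj
  choose l hl using hj
  have : PreservesColimitsOfSize.{0, 0} M := preservesColimitsOfSize_shrink.{0, u, 0, u} M
  let d := Limits.Sigma.desc fun i => (presheafToSheaf J (Type u)).map (m i)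
  have : Epi d := by
    refine ⟨fun {Z} f g h => ?_⟩
    refine hm.sheafify_hom_ext fun i => ?_
    have := congrArg (Limits.Sigma.ι _ i ≫ ·) h
    simpa only [d, Limits.Sigma.ι_desc_assoc] using this
  have : IsRegularEpi d := IsRegularEpiCategory.regularEpiOfEpi d
  have : IsRegularEpi (M.map d) := isRegularEpi_map_of_preservesColimits M d
  let c := isColimitCofanMkObjOfIsColimit M _ _
    (coproductIsCoproduct fun i => (presheafToSheaf J (Type u)).obj (U i))
  let k := Cofan.IsColimit.desc c l
  have hk : k ≫ j = M.map d := by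
    refine Cofan.IsColimit.hom_ext c _ _ fun i => ?_
    rw [Cofan.IsColimit.fac_assoc]
    refine (hl i).trans ?_
    change _ = M.map _ ≫ M.map d
    rw [← M.map_comp]
    simp [d]
  have : StrongEpi (M.map d) := inferInstance
  have : IsSplitEpi j := by
    have sq : CommSq k (M.map d) j (𝟙 _) := ⟨by simpa using hk⟩
    exact ⟨⟨⟨sq.lift, sq.fac_right⟩⟩⟩
  exact isIso_of_mono_of_isSplitEpi j

/-- If the family `m i : U i ⟶ W` is jointly extremal, then a subobject `w : W ⟶ X` is the union of
the subobjects `m i ≫ w`. -/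
lemma JointlyExtremal.isLUB {E : Type*} [Category* E] [HasPullbacks E] {ι : Type*} {U : ι → E}
    {W X : E} {m : ∀ i, U i ⟶ W} (hm : JointlyExtremal m) (w : W ⟶ X) [Mono w]
    (n : ∀ i, U i ⟶ X) (hn : ∀ i, m i ≫ w = n i)
    (hmono : ∀ i, Mono (n i) := by infer_instance) :
    IsLUB (Set.range fun i => Subobject.mk (n i)) (Subobject.mk w) := by
  constructor
  · rintro _ ⟨i, rfl⟩
    exact Subobject.mk_le_mk_of_comm (m i) (hn i)
  · intro z hz
    have (i : ι) : z.Factors (n i) :=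
      (Subobject.factors_iff _ _).2 ⟨Subobject.ofMkLE (n i) z (hz ⟨i, rfl⟩),
        Subobject.ofMkLE_arrow _⟩
    have : IsIso (pullback.snd z.arrow w) := hm _ fun i =>
      ⟨pullback.lift (z.factorThru _ (this i)) (m i)
        ((Subobject.factorThru_arrow _ _ _).trans (hn i).symm), pullback.lift_snd _ _ _⟩
    refine Subobject.mk_le_of_comm (inv (pullback.snd z.arrow w) ≫ pullback.fst z.arrow w) ?_
    rw [Category.assoc, pullback.condition, IsIso.inv_hom_id_assoc]

end JointlySurjective

/-! ### The sheaves of germs -/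

section Sheaves

variable {C : Type u} [SmallCategory C] [CoherentCategory C]

/-- The presheaf represented by `(x, p)`, as a subpresheaf of the presheaf of germs of maps to
`x`. -/
def germInclusion (a : Spec C) : yoneda.obj a ⟶ (germFunctor C).obj a.pt where
  app _ := TypeCat.ofHom fun k => k.1
  naturality _ _ _ := rfl

instance (a : Spec C) : Mono (germInclusion a) := by
  have (b : (Spec C)ᵒᵖ) : Mono ((germInclusion a).app b) :=
    (mono_iff_injective _).2 Subtype.val_injective
  exact NatTrans.mono_of_mono_app _

/-- The inclusion of the presheaf represented by `(x, p)` into the presheaf of germs of maps to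
a member `w` of `p`. -/
def germRestrict (a : Spec C) (w : Subobject a.pt) (hw : w ∈ a.filter.1) :
    yoneda.obj a ⟶ (germFunctor C).obj (w : C) where
  app _ := TypeCat.ofHom fun k => Germ.comp k (Germ.mk ⟨w, hw, 𝟙 _⟩)
  naturality _ _ f := by
    ext k
    exact Germ.comp_assoc f.unop k _

lemma germRestrict_comp (a : Spec C) (w : Subobject a.pt) (hw : w ∈ a.filter.1) :
    germRestrict a w hw ≫ (germFunctor C).map w.arrow = germInclusion a := by
  ext b k
  refine (Germ.comp_postcomp k _ _).trans ?_
  have : (Germ.mk ⟨w, hw, 𝟙 _⟩ : Germ a.filter (w : C)).postcomp w.arrow =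
      Germ.ofHom a.filter (𝟙 a.pt) :=
    Germ.mk_eq ⟨w, hw, le_rfl, le_top, by simp [PartialHom.ofHom]⟩
  rw [this, Germ.comp_ofHom, Germ.postcomp_id]
  rfl

instance {x y : C} (f : x ⟶ y) [Mono f] : Mono ((germFunctor C).map f) := by
  have (b : (Spec C)ᵒᵖ) : Mono (((germFunctor C).map f).app b) :=
    (mono_iff_injective _).2 (Germ.postcomp_injective f)
  exact NatTrans.mono_of_mono_app _

/-- Germs lift locally along effective epimorphisms: a germ defined on `u` lifts on the pullback
to `u`, which covers the germ of the identity of `u`. -/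
lemma jointlyLocallySurjective_of_effectiveEpi {x y : C} (f : x ⟶ y) [EffectiveEpi f] :
    JointlyLocallySurjective (topology C) fun _ : PUnit.{u + 1} => (germFunctor C).map f := by
  rintro ⟨z, p⟩ (s : Germ p y)
  induction s using Germ.ind with | h s => ?_
  let i : Germ p (s.dom : C) := Germ.mk ⟨s.dom, s.mem, 𝟙 _⟩
  let r : Spec.mk z p ⟶ Spec.mk _ i.pushforward := ⟨i, fun _ h => h⟩
  have hs : Germ.mk s = i.postcomp s.map :=
    Germ.mk_eq ⟨s.dom, s.mem, le_rfl, le_rfl, by simp⟩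
  have hf : IsRegularEpi f := (isRegularEpi_iff_effectiveEpi f).2 inferInstance
  have he : EffectiveEpi (pullback.snd f s.map) :=
    (isRegularEpi_iff_effectiveEpi _).1 inferInstance
  refine (topology C).superset_covering ?_ ((topology C).pullback_stable r
    (Precoverage.generate_mem_toGrothendieck (J := effectiveEpiFamilies C)
      (R := coveringFamily (Spec.mk _ i.pushforward) (pullback.snd f s.map)) ⟨_, _, he, rfl⟩))
  rintro b k ⟨_, l, _, ⟨q⟩, hl⟩
  refine ⟨PUnit.unit, Germ.postcomp l.1 (pullback.fst f s.map), ?_⟩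
  have h₁ : Germ.comp k i = l.1.postcomp (pullback.snd f s.map) :=
    (congrArg Subtype.val hl).symm.trans (Germ.comp_ofHom _ _)
  change (Germ.postcomp l.1 (pullback.fst f s.map)).postcomp f = Germ.comp k (Germ.mk s)
  rw [hs, ← Germ.comp_postcomp, h₁, ← Germ.postcomp_postcomp, ← Germ.postcomp_postcomp,
    pullback.condition]

lemma jointlyLocallySurjective_of_isLUB {x : C} {a b w : Subobject x} (hw : IsLUB {a, b} w) :
    JointlyLocallySurjective (topology C) fun c : ({a, b} : Set (Subobject x)) =>
      (germFunctor C).map (Subobject.ofLE c.1 w (hw.1 c.2)) := by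
  refine .of_forall_exists fun d s => ?_
  obtain ⟨t, ht⟩ | ⟨t, ht⟩ :=
    Germ.exists_postcomp_of_isLUB hw (hw.1 (by simp)) (hw.1 (by simp)) s
  exacts [⟨⟨a, by simp⟩, t, ht⟩, ⟨⟨b, by simp⟩, t, ht⟩]

lemma jointlyLocallySurjective_of_isBot {x : C} {w : Subobject x} (hw : IsBot w)
    (U : PEmpty.{u + 1} → (Spec C)ᵒᵖ ⥤ Type u) (m : ∀ i, U i ⟶ (germFunctor C).obj (w : C)) :
    JointlyLocallySurjective (topology C) m :=
  .of_forall_exists fun _ s => ((Germ.isEmpty_of_isBot hw).false s).elim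

/-- The presheaf of germs of maps to `x` is the union of the presheaves represented by the
`(x, q)`: every germ factors through the image of the filter on which it is defined. -/
lemma jointlyLocallySurjective_germInclusion (x : C) :
    JointlyLocallySurjective (topology C) (U := fun q : PrimeFilter x => yoneda.obj (Spec.mk x q))
      (X := (germFunctor C).obj x) fun q => germInclusion (Spec.mk x q) :=
  .of_forall_exists fun d (s : Germ d.filter x) => ⟨s.pushforward, ⟨s, fun _ h => h⟩, rfl⟩

/-- Within the germs of maps to `x`, the intersection of the presheaf represented by `(x, q)` with
the germs of maps to a subobject `w` is the union of the presheaves represented by the `(x, q')`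
with `q ≤ q'` and `w ∈ q'`. -/
lemma jointlyLocallySurjective_inter {x : C} (q : PrimeFilter x) (w : Subobject x) :
    JointlyLocallySurjective (topology C) fun r : {r : PrimeFilter x // q ≤ r ∧ w ∈ r.1} =>
      pullback.lift (f := germInclusion (Spec.mk x q)) (g := (germFunctor C).map w.arrow)
        (yoneda.map (Spec.idOfLE r.2.1)) (germRestrict (Spec.mk x r.1) w r.2.2)
        (by
          rw [germRestrict_comp]
          ext b k
          exact (Germ.comp_ofHom k _).trans (Germ.postcomp_id _)) := by
  refine .of_forall_exists fun d s => ?_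
  let k : d ⟶ Spec.mk x q := (pullback.fst (germInclusion (Spec.mk x q))
    ((germFunctor C).map w.arrow)).app _ s
  have hk : k.1.PushMem w := (Germ.pushMem_iff_exists _ _).2 ⟨(pullback.snd
    (germInclusion (Spec.mk x q)) ((germFunctor C).map w.arrow)).app _ s,
    (ConcreteCategory.congr_hom (NatTrans.congr_app (pullback.condition
      (f := germInclusion (Spec.mk x q)) (g := (germFunctor C).map w.arrow)) (op d)) s).symm⟩
  refine ⟨⟨k.1.pushforward, fun v hv => k.2 v hv, hk⟩, ⟨k.1, fun _ h => h⟩, ?_⟩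
  have : Mono (pullback.fst (germInclusion (Spec.mk x q)) ((germFunctor C).map w.arrow)) :=
    inferInstance
  refine (mono_iff_injective _).1 ((NatTrans.mono_iff_mono_app _).1 this (op d)) ?_
  rw [← ConcreteCategory.comp_apply, ← NatTrans.comp_app, pullback.lift_fst]
  exact Subtype.ext ((Germ.comp_ofHom _ _).trans (Germ.postcomp_id _))

variable {E : Type*} [Category* E]

instance : PreservesFiniteLimits (phi C) := comp_preservesFiniteLimits _ _

instance (M : SpecTopos C ⥤ E) [PreservesFiniteLimits M] : PreservesFiniteLimits (phi C ⋙ M) :=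
  comp_preservesFiniteLimits _ _

/-- A functor `M` on the topos of prime filters that preserves finite limits and small colimits
restricts to a coherent functor along `φ`. -/
theorem isCoherentFunctor_phi_comp [HasPullbacks E] (M : SpecTopos C ⥤ E)
    [PreservesFiniteLimits M] [PreservesColimitsOfSize.{u, u} M] :
    IsCoherentFunctor (phi C ⋙ M) where
  effectiveEpi := by
    refine ⟨fun {x y} f _ => ?_⟩
    have : Epi ((phi C).map f) := ⟨fun _ _ h =>
      (jointlyLocallySurjective_of_effectiveEpi f).sheafify_hom_ext fun _ => h⟩
    have : IsRegularEpi ((phi C).map f) := IsRegularEpiCategory.regularEpiOfEpi _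
    have : PreservesColimitsOfSize.{0, 0} M := preservesColimitsOfSize_shrink.{0, u, 0, u} M
    have : IsRegularEpi (M.map ((phi C).map f)) := isRegularEpi_map_of_preservesColimits _ _
    exact (isRegularEpi_iff_effectiveEpi _).1 this
  isBot := by
    intro x w hw
    have h₀ := (jointlyLocallySurjective_of_isBot hw (fun i => i.elim)
      (fun i => i.elim)).jointlyExtremal M
    have h : JointlyExtremal (U := fun _ : PEmpty.{u + 1} => (phi C ⋙ M).obj (w : C))
        (X := (phi C ⋙ M).obj (w : C)) fun _ => 𝟙 _ := fun A j hj _ =>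
      @h₀ A j hj (fun i => i.elim)
    have hL := h.isLUB ((phi C ⋙ M).map w.arrow) (fun _ => (phi C ⋙ M).map w.arrow)
      (fun i => i.elim)
    rw [Set.range_eq_empty, isLUB_empty_iff] at hL
    exact hL
  isLUB := by
    intro x a b w hw
    have h : JointlyExtremal (U := fun c : ({a, b} : Set (Subobject x)) => (phi C ⋙ M).obj c.1)
        (X := (phi C ⋙ M).obj (w : C))
        fun c => (phi C ⋙ M).map (Subobject.ofLE c.1 w (hw.1 c.2)) :=
      (jointlyLocallySurjective_of_isLUB hw).jointlyExtremal M
    have hL := h.isLUB ((phi C ⋙ M).map w.arrow) (fun c => (phi C ⋙ M).map c.1.arrow)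
      (fun c => ((phi C ⋙ M).map_comp _ _).symm.trans
        (congrArg (phi C ⋙ M).map (Subobject.ofLE_arrow _)))
    convert! hL using 1
    ext z
    simp [mapSubobject, eq_comm (a := z)]

end Sheaves

/-! ### Natural transformations between cocontinuous functors on sheaves -/

section Extension

variable {D : Type u} [SmallCategory D] {J : GrothendieckTopology D}
  {E : Type u₁} [Category.{v₁} E]

/-- Every presheaf is the union of the images of the representables that map to it. -/
lemma jointlyLocallySurjective_yoneda (X : Dᵒᵖ ⥤ Type u) :
    JointlyLocallySurjective J fun i : Σ d : D, X.obj (op d) => yonedaEquiv.symm i.2 :=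
  .of_forall_exists fun d s => ⟨⟨d, s⟩, 𝟙 d, by simp [yonedaEquiv_symm_app_apply]⟩

lemma JointlyExtremal.hom_ext [HasEqualizers E] {ι : Type*} {U : ι → E} {X Z : E}
    {m : ∀ i, U i ⟶ X} (hm : JointlyExtremal m) {f g : X ⟶ Z} (h : ∀ i, m i ≫ f = m i ≫ g) :
    f = g := by
  have : IsIso (equalizer.ι f g) := hm _ fun i => ⟨equalizer.lift _ (h i), equalizer.lift_ι _ _⟩
  exact (cancel_epi (equalizer.ι f g)).1 (equalizer.condition f g)

/-- Natural transformations out of a cocontinuous functor on sheaves are determined by their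
components at the sheafified representables. -/
lemma natTrans_ext_of_sheafYoneda [HasEqualizers E] {M M' : Sheaf J (Type u) ⥤ E}
    [PreservesColimitsOfSize.{u, u} M] {β γ : M ⟶ M'}
    (h : ∀ d, β.app ((presheafToSheaf J (Type u)).obj (yoneda.obj d)) =
      γ.app ((presheafToSheaf J (Type u)).obj (yoneda.obj d))) : β = γ := by
  have key (P : Dᵒᵖ ⥤ Type u) : β.app ((presheafToSheaf J (Type u)).obj P) =
      γ.app ((presheafToSheaf J (Type u)).obj P) :=
    ((jointlyLocallySurjective_yoneda P).jointlyExtremal M).hom_ext fun i =>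
      (β.naturality _).trans ((congrArg (· ≫ _) (h i.1)).trans (γ.naturality _).symm)
  ext S
  rw [← cancel_epi (M.map ((sheafificationAdjunction J (Type u)).counit.app S))]
  exact (β.naturality _).trans ((congrArg (· ≫ _) (key _)).trans (γ.naturality _).symm)

/-- Natural transformations defined on the sheafified representables extend along cocontinuous
functors. -/
lemma exists_natTrans_of_sheafYoneda {E : Type u₁} [Category.{u} E] [HasColimitsOfSize.{u, u} E]
    {M M' : Sheaf J (Type u) ⥤ E} [PreservesColimitsOfSize.{u, u} M]
    (β : (yoneda ⋙ presheafToSheaf J (Type u)) ⋙ M ⟶ (yoneda ⋙ presheafToSheaf J (Type u)) ⋙ M') :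
    ∃ γ : M ⟶ M', ∀ d, γ.app ((presheafToSheaf J (Type u)).obj (yoneda.obj d)) = β.app d := by
  let L := presheafToSheaf J (Type u) ⋙ M
  let L' := presheafToSheaf J (Type u) ⋙ M'
  let i : uliftYoneda.{u} (C := D) ≅ yoneda := uliftYonedaIsoYoneda.{u}
  let e : yoneda ⋙ L ≅ uliftYoneda.{u} ⋙ L := Functor.isoWhiskerRight i.symm L
  have : PreservesColimitsOfSize.{u, u} L := inferInstance
  have : L.IsLeftKanExtension e.hom :=
    Presheaf.isLeftKanExtension_of_preservesColimits L e
  let γ₀ : L ⟶ L' := L.descOfIsLeftKanExtension e.hom L' (β ≫ Functor.whiskerRight i.inv L')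
  have hγ₀ (d : D) : γ₀.app (yoneda.obj d) = β.app d := by
    have h := L.descOfIsLeftKanExtension_fac_app e.hom L' (β ≫ Functor.whiskerRight i.inv L') d
    rw [← cancel_mono (L'.map (i.inv.app d))]
    exact (γ₀.naturality (i.inv.app d)).symm.trans h
  let ε := (sheafificationAdjunction J (Type u)).counit
  let η := (sheafificationAdjunction J (Type u)).unit
  refine ⟨{ app := fun S => M.map (inv (ε.app S)) ≫ γ₀.app S.obj ≫ M'.map (ε.app S)
            naturality := fun S T f => ?_ }, fun d => ?_⟩
  · have h : f ≫ inv (ε.app T) =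
        inv (ε.app S) ≫ (presheafToSheaf J (Type u)).map ((sheafToPresheaf J (Type u)).map f) := by
      rw [IsIso.comp_inv_eq, Category.assoc, IsIso.eq_inv_comp]
      exact (ε.naturality f).symm
    rw [← M.map_comp_assoc, h, M.map_comp, Category.assoc, Category.assoc, Category.assoc,
      ← M'.map_comp]
    congr 1
    have h₁ := γ₀.naturality ((sheafToPresheaf J (Type u)).map f)
    have h₂ := congrArg M'.map (ε.naturality f)
    rw [← Category.assoc]
    refine (congrArg (· ≫ _) h₁).trans ((Category.assoc _ _ _).trans (congrArg (_ ≫ ·) ?_))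
    exact (M'.map_comp _ _).symm.trans h₂
  · have h : inv (ε.app ((presheafToSheaf J (Type u)).obj (yoneda.obj d))) =
        (presheafToSheaf J (Type u)).map (η.app (yoneda.obj d)) :=
      IsIso.inv_eq_of_inv_hom_id
        ((sheafificationAdjunction J (Type u)).left_triangle_components _)
    have h₁ := γ₀.naturality (η.app (yoneda.obj d))
    dsimp only
    rw [h, ← hγ₀, ← Category.assoc]
    refine (congrArg (· ≫ _) h₁).trans ((Category.assoc _ _ _).trans ?_)
    refine (congrArg (_ ≫ ·) ((M'.map_comp _ _).symm.trans ((congrArg M'.map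
      ((sheafificationAdjunction J (Type u)).left_triangle_components _)).trans
        (M'.map_id _)))).trans (Category.comp_id _)

end Extension

/-! ### Functors that preserve the intersections of prime filters -/

section Intersections

variable {C : Type u} [SmallCategory C] [CoherentCategory C] {E : Type u₁} [Category.{v₁} E]

/-- The inclusion of the sheafified representable `#Y(x, p)` into `φ x`. -/
def sheafInclusion (a : Spec C) : (sheafYoneda C).obj a ⟶ (phi C).obj a.pt :=
  (presheafToSheaf (topology C) (Type u)).map (germInclusion a)

instance (a : Spec C) : Mono (sheafInclusion a) :=
  (presheafToSheaf (topology C) (Type u)).map_mono (germInclusion a)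

lemma mono_map_sheafInclusion (M : SpecTopos C ⥤ E) [PreservesFiniteLimits M] (a : Spec C) :
    Mono (M.map (sheafInclusion a)) := inferInstance

/-- The inclusion of `#Y(x, p)` into `φ w`, for a member `w` of `p`. -/
def sheafRestrict (a : Spec C) (w : Subobject a.pt) (hw : w ∈ a.filter.1) :
    (sheafYoneda C).obj a ⟶ (phi C).obj (w : C) :=
  (presheafToSheaf (topology C) (Type u)).map (germRestrict a w hw)

lemma sheafRestrict_comp (a : Spec C) (w : Subobject a.pt) (hw : w ∈ a.filter.1) :
    sheafRestrict a w hw ≫ (phi C).map w.arrow = sheafInclusion a :=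
  ((presheafToSheaf (topology C) (Type u)).map_comp _ _).symm.trans
    (congrArg _ (germRestrict_comp a w hw))

lemma yoneda_map_idOfLE_comp {x : C} {p q : PrimeFilter x} (h : q ≤ p) :
    yoneda.map (Spec.idOfLE h) ≫ germInclusion (Spec.mk x q) = germInclusion (Spec.mk x p) := by
  ext b k
  exact (Germ.comp_ofHom k _).trans (Germ.postcomp_id _)

lemma sheafYoneda_map_idOfLE_comp {x : C} {p q : PrimeFilter x} (h : q ≤ p) :
    (sheafYoneda C).map (Spec.idOfLE h) ≫ sheafInclusion (Spec.mk x q) =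
      sheafInclusion (Spec.mk x p) :=
  ((presheafToSheaf (topology C) (Type u)).map_comp _ _).symm.trans
    (congrArg _ (yoneda_map_idOfLE_comp h))

/-- The property of a functor `M` on the topos of prime filters that `M(#Y(x, p))` is the
intersection, in `M(φ x)`, of the subobjects `M(φ w)` for `w` in `p`. -/
def PreservesFilterInter (M : SpecTopos C ⥤ E) : Prop :=
  ∀ (a : Spec C) {Z : E} (k : Z ⟶ M.obj ((phi C).obj a.pt)),
    (∀ w ∈ a.filter.1, ∃ l : Z ⟶ M.obj ((phi C).obj (w : C)),
      l ≫ M.map ((phi C).map w.arrow) = k) →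
    ∃ l : Z ⟶ M.obj ((sheafYoneda C).obj a), l ≫ M.map (sheafInclusion a) = k

/-- A cone over a diagram of subobjects of `B` is a limit cone if its vertex is the intersection of
these subobjects. -/
lemma nonempty_isLimit_of_mono {K : Type*} [Category* K] {G : K ⥤ E} (c : Cone G) {B : E}
    (b : ∀ k, G.obj k ⟶ B) (hb : ∀ k, Mono (b k)) (binf : c.pt ⟶ B) (_ : Mono binf)
    (hc : ∀ k, c.π.app k ≫ b k = binf) (k₀ : K)
    (hG : ∀ (s : Cone G) k, s.π.app k ≫ b k = s.π.app k₀ ≫ b k₀)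
    (hl : ∀ s : Cone G, ∃ l, l ≫ binf = s.π.app k₀ ≫ b k₀) : Nonempty (IsLimit c) := by
  choose l hl using hl
  refine ⟨{ lift := l, fac := fun s k => ?_, uniq := fun s m hm => ?_ }⟩
  · rw [← cancel_mono (b k), Category.assoc, hc, hl, ← hG s k]
  · rw [← cancel_mono binf, hl, ← hm, Category.assoc, hc]

/-- As a union of filters contains the members of each of them, intersections over filters are
compatible with unions of chains. -/
lemma PreservesFilterInter.nonempty_isLimit {M : SpecTopos C ⥤ E} [PreservesFiniteLimits M]
    (hM : PreservesFilterInter M) {x : C} {ι : Type u} [LinearOrder ι] (p : ι →o PrimeFilter x)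
    (pinf : PrimeFilter x) (h : ∀ i, p i ≤ pinf) (hp : ∀ w, w ∈ pinf.1 ↔ ∃ i, w ∈ (p i).1) :
    Nonempty (IsLimit ((sheafYoneda C ⋙ M).mapCone (chainCone p pinf h))) := by
  obtain ⟨i₀, -⟩ := (hp ⊤).1 Order.PFilter.top_mem
  have hcompat (s : Cone (chainDiagram p ⋙ sheafYoneda C ⋙ M)) {i j : ι} (hij : i ≤ j) :
      s.π.app (op i) ≫ M.map (sheafInclusion (Spec.mk x (p i))) =
        s.π.app (op j) ≫ M.map (sheafInclusion (Spec.mk x (p j))) := by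
    rw [← s.w (homOfLE hij).op, Category.assoc]
    exact congrArg (s.π.app (op j) ≫ ·) ((M.map_comp _ _).symm.trans
      (congrArg M.map (sheafYoneda_map_idOfLE_comp (p.monotone hij))))
  have hcompat' (s : Cone (chainDiagram p ⋙ sheafYoneda C ⋙ M)) (i j : ι) :
      s.π.app (op i) ≫ M.map (sheafInclusion (Spec.mk x (p i))) =
        s.π.app (op j) ≫ M.map (sheafInclusion (Spec.mk x (p j))) :=
    (le_total i j).elim (hcompat s) fun hij => (hcompat s hij).symm
  refine nonempty_isLimit_of_mono _ (fun i => M.map (sheafInclusion (Spec.mk x (p i.unop))))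
    (fun i => mono_map_sheafInclusion M _) (M.map (sheafInclusion (Spec.mk x pinf)))
    (mono_map_sheafInclusion M _) (fun i => ?_) (op i₀)
    (fun s i => hcompat' s i.unop i₀) fun s => ?_
  · exact (M.map_comp _ _).symm.trans (congrArg _ (sheafYoneda_map_idOfLE_comp (h i.unop)))
  · refine hM (Spec.mk x pinf) _ fun w hw => ?_
    obtain ⟨i, hi⟩ := (hp w).1 hw
    refine ⟨s.π.app (op i) ≫ M.map (sheafRestrict (Spec.mk x (p i)) w hi), ?_⟩
    refine (Category.assoc _ _ _).trans (Eq.trans ?_ (hcompat' s i i₀))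
    exact congrArg (_ ≫ ·) ((M.map_comp _ _).symm.trans
      (congrArg _ (sheafRestrict_comp (Spec.mk x (p i)) w hi)))

/-- Morphisms of prime filters are, on a member of the filter, given by morphisms of `C`. -/
lemma sheafYoneda_map_comp_sheafInclusion {a b : Spec C} (f : a ⟶ b) :
    ∃ (w : Subobject a.pt) (hw : w ∈ a.filter.1) (g : (w : C) ⟶ b.pt),
      (sheafYoneda C).map f ≫ sheafInclusion b = sheafRestrict a w hw ≫ (phi C).map g := by
  obtain ⟨f, hf⟩ := f
  induction f using Germ.ind with | h f => ?_
  refine ⟨f.dom, f.mem, f.map, ((presheafToSheaf (topology C) (Type u)).map_comp _ _).symm.trans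
    (Eq.trans (congrArg _ ?_) ((presheafToSheaf (topology C) (Type u)).map_comp _ _))⟩
  ext c k
  have h : Germ.postcomp (Germ.mk ⟨f.dom, f.mem, 𝟙 _⟩ : Germ a.filter (f.dom : C)) f.map =
      Germ.mk f := Germ.mk_eq ⟨f.dom, f.mem, le_rfl, le_rfl, by simp⟩
  exact (congrArg (Germ.comp k) h).symm.trans (Germ.comp_postcomp k _ f.map).symm

/-- Natural transformations are determined by their components at the `φ x`, as `M'(#Y(x, p))` is a
subobject of `M'(φ x)`. -/
lemma natTrans_ext_of_whiskerLeft_phi [HasEqualizers E] {M M' : SpecTopos C ⥤ E}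
    [PreservesColimitsOfSize.{u, u} M] [PreservesFiniteLimits M'] {β γ : M ⟶ M'}
    (h : Functor.whiskerLeft (phi C) β = Functor.whiskerLeft (phi C) γ) : β = γ := by
  refine natTrans_ext_of_sheafYoneda fun a => ?_
  have := mono_map_sheafInclusion M' a
  refine (cancel_mono (M'.map (sheafInclusion a))).1 ?_
  refine (β.naturality (sheafInclusion a)).symm.trans (Eq.trans ?_
    (γ.naturality (sheafInclusion a)))
  exact congrArg (_ ≫ ·) (NatTrans.congr_app h a.pt)

/-- A natural transformation `φ ⋙ M ⟶ φ ⋙ M'` restricts to the intersections `#Y(x, p)` of the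
`φ w`, and hence extends to a natural transformation `M ⟶ M'`. -/
lemma PreservesFilterInter.exists_natTrans {E : Type u₁} [Category.{u} E]
    [HasColimitsOfSize.{u, u} E] [HasEqualizers E] {M M' : SpecTopos C ⥤ E}
    [PreservesColimitsOfSize.{u, u} M] [PreservesFiniteLimits M']
    (hM' : PreservesFilterInter M') (α : phi C ⋙ M ⟶ phi C ⋙ M') :
    ∃ γ : M ⟶ M', Functor.whiskerLeft (phi C) γ = α := by
  have hβ (a : Spec C) : ∃ l : M.obj ((sheafYoneda C).obj a) ⟶ M'.obj ((sheafYoneda C).obj a),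
      l ≫ M'.map (sheafInclusion a) = M.map (sheafInclusion a) ≫ α.app a.pt := by
    refine hM' a _ fun w hw => ⟨M.map (sheafRestrict a w hw) ≫ α.app w, ?_⟩
    rw [← sheafRestrict_comp a w hw, M.map_comp, Category.assoc, Category.assoc]
    exact congrArg (_ ≫ ·) (α.naturality w.arrow).symm
  choose β hβ using hβ
  have hβ' (a : Spec C) (w : Subobject a.pt) (hw : w ∈ a.filter.1) :
      β a ≫ M'.map (sheafRestrict a w hw) = M.map (sheafRestrict a w hw) ≫ α.app w := by
    refine (cancel_mono (M'.map ((phi C).map w.arrow))).1 ?_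
    rw [Category.assoc, ← M'.map_comp, sheafRestrict_comp, hβ, ← sheafRestrict_comp a w hw,
      M.map_comp, Category.assoc, Category.assoc]
    exact congrArg (_ ≫ ·) (α.naturality w.arrow)
  let β₀ : (yoneda ⋙ presheafToSheaf (topology C) (Type u)) ⋙ M ⟶
      (yoneda ⋙ presheafToSheaf (topology C) (Type u)) ⋙ M' :=
    { app := β
      naturality := fun a b f => by
        obtain ⟨w, hw, g, hg⟩ := sheafYoneda_map_comp_sheafInclusion f
        have := mono_map_sheafInclusion M' b
        change M.map ((sheafYoneda C).map f) ≫ β b = β a ≫ M'.map ((sheafYoneda C).map f)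
        refine (cancel_mono (M'.map (sheafInclusion b))).1 ?_
        rw [Category.assoc, Category.assoc, hβ, ← M'.map_comp, ← M.map_comp_assoc, hg, M.map_comp,
          M'.map_comp, ← Category.assoc (β a), hβ', Category.assoc, Category.assoc]
        exact congrArg (_ ≫ ·) (α.naturality g) }
  obtain ⟨γ, hγ⟩ := exists_natTrans_of_sheafYoneda β₀
  refine ⟨γ, ?_⟩
  ext x
  refine ((jointlyLocallySurjective_germInclusion x).jointlyExtremal M).hom_ext fun p => ?_
  refine (γ.naturality (sheafInclusion (Spec.mk x p))).trans (Eq.trans ?_ (hβ (Spec.mk x p)))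
  exact congrArg (· ≫ _) (hγ (Spec.mk x p))

end Intersections

/-! ### Unions of subobjects and prime objects in a topos of sheaves -/

section Primes

/-- An object is prime if it is a prime subobject of itself. -/
def IsPrimeObject {E : Type u₁} [Category.{v₁} E] (A : E) : Prop :=
  IsPrimeSubobject (⊤ : Subobject A)

lemma IsPrimeSubobject.isPrimeObject {E : Type u₁} [Category.{v₁} E] [HasPullbacks E] {X : E}
    {a : Subobject X} (ha : IsPrimeSubobject a) : IsPrimeObject (a : E) := by
  intro T hT
  have hmap : (Subobject.map a.arrow).obj ⊤ = a := by
    rw [Subobject.map_top, Subobject.mk_arrow]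
  have adj (s : Subobject (a : E)) (z : Subobject X) :
      (Subobject.map a.arrow).obj s ≤ z ↔ s ≤ (Subobject.pullback a.arrow).obj z :=
    (Subobject.mapPullbackAdj a.arrow).gc s z
  have h : IsLUB ((Subobject.map a.arrow).obj '' T) a := by
    constructor
    · rintro _ ⟨t, -, rfl⟩
      exact ((adj t _).2 (le_top.trans ((adj ⊤ _).1 le_rfl))).trans hmap.le
    · intro z hz
      rw [← hmap, adj]
      exact hT.2 fun t ht => (adj t z).1 (hz ⟨t, ht, rfl⟩)
  obtain ⟨t, ht, e⟩ := ha _ h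
  rwa [Subobject.map_obj_injective a.arrow (e.trans hmap.symm)] at ht

variable {D : Type u} [SmallCategory D] {J : GrothendieckTopology D}

/-- Sections of a sheaf, as morphisms from the sheafified representables. -/
def sectionEquiv {d : D} {X : Sheaf J (Type u)} :
    ((presheafToSheaf J (Type u)).obj (yoneda.obj d) ⟶ X) ≃ X.obj.obj (op d) :=
  ((sheafificationAdjunction J (Type u)).homEquiv _ _).trans yonedaEquiv

lemma sectionEquiv_comp {d : D} {X Y : Sheaf J (Type u)}
    (s : (presheafToSheaf J (Type u)).obj (yoneda.obj d) ⟶ X) (f : X ⟶ Y) :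
    sectionEquiv (s ≫ f) = f.hom.app _ (sectionEquiv s) :=
  (congrArg yonedaEquiv
    ((sheafificationAdjunction J (Type u)).homEquiv_naturality_right s f)).trans
    (yonedaEquiv_comp _ _)

lemma sectionEquiv_map_comp {d e : D} {X : Sheaf J (Type u)} (g : e ⟶ d)
    (s : (presheafToSheaf J (Type u)).obj (yoneda.obj d) ⟶ X) :
    sectionEquiv ((presheafToSheaf J (Type u)).map (yoneda.map g) ≫ s) =
      X.obj.map g.op (sectionEquiv s) :=
  (congrArg yonedaEquiv
    ((sheafificationAdjunction J (Type u)).homEquiv_naturality_left (yoneda.map g) s)).trans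
    (yonedaEquiv_naturality _ _).symm

lemma sectionEquiv_symm_comp {d : D} {X Y : Sheaf J (Type u)} (s : X.obj.obj (op d)) (f : X ⟶ Y) :
    sectionEquiv.symm s ≫ f = sectionEquiv.symm (f.hom.app _ s) := by
  rw [Equiv.eq_symm_apply, sectionEquiv_comp, Equiv.apply_symm_apply]

lemma jointImageSieve_mono {D : Type u₁} [Category.{v₁} D] {ι κ : Type*} {U : ι → Dᵒᵖ ⥤ Type u}
    {V : κ → Dᵒᵖ ⥤ Type u} {X : Dᵒᵖ ⥤ Type u} {m : ∀ i, U i ⟶ X} {n : ∀ k, V k ⟶ X}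
    (h : ∀ i, ∃ k, ∃ l, l ≫ n k = m i) {d : D} (s : X.obj (op d)) :
    jointImageSieve m s ≤ jointImageSieve n s := by
  rintro e f ⟨i, t, ht⟩
  obtain ⟨k, l, hl⟩ := h i
  exact ⟨k, l.app _ t, by rw [← ht, ← hl]; rfl⟩

/-- Local lifts of the sections of `Z` along the members of a family, in terms of pullbacks. -/
lemma jointlyLocallySurjective_pullback {ι : Type*} {U : ι → Sheaf J (Type u)}
    {X Z : Sheaf J (Type u)} {n : ∀ i, U i ⟶ X} {k : Z ⟶ X}
    (h : ∀ d (z : Z.obj.obj (op d)),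
      jointImageSieve (fun i => (n i).hom) (k.hom.app _ z) ∈ J d) :
    JointlyLocallySurjective J fun i => (pullback.snd (n i) k).hom := by
  intro d z
  refine J.superset_covering ?_ (h d z)
  rintro e f ⟨i, t, ht⟩
  refine ⟨i, sectionEquiv (pullback.lift (sectionEquiv.symm t)
    (sectionEquiv.symm (Z.obj.map f.op z)) ?_), ?_⟩
  · rw [sectionEquiv_symm_comp, sectionEquiv_symm_comp, ht, NatTrans.naturality_apply]
  · rw [← sectionEquiv_comp, pullback.lift_snd, Equiv.apply_symm_apply]

lemma isIso_of_mono_of_locallySurjective {A X : Sheaf J (Type u)} (j : A ⟶ X) [Mono j]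
    (h : JointlyLocallySurjective J fun _ : Unit => j.hom) : IsIso j := by
  have : Sheaf.IsLocallySurjective j := by
    refine ⟨fun {d} s => J.superset_covering ?_ (h s)⟩
    rintro e f ⟨_, t, ht⟩
    exact ⟨t, ht⟩
  have : Epi j := Sheaf.epi_of_isLocallySurjective j
  exact isIso_of_mono_of_epi j

lemma JointlyLocallySurjective.jointlyExtremal_of_sheaf {ι : Type*} {U : ι → Sheaf J (Type u)}
    {X : Sheaf J (Type u)} {m : ∀ i, U i ⟶ X}
    (hm : JointlyLocallySurjective J fun i => (m i).hom) : JointlyExtremal m := by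
  intro A j _ hj
  refine isIso_of_mono_of_locallySurjective j fun d s =>
    J.superset_covering (jointImageSieve_mono (fun i => ⟨(), ?_⟩) s) (hm s)
  obtain ⟨l, hl⟩ := hj i
  exact ⟨l.hom, congrArg (·.hom) hl⟩

/-- A morphism whose sections belong locally to a subsheaf factors through it. -/
lemma exists_comp_eq_of_locally {A X Z : Sheaf J (Type u)} (j : A ⟶ X) [Mono j] (k : Z ⟶ X)
    (h : ∀ d (z : Z.obj.obj (op d)),
      jointImageSieve (fun _ : Unit => j.hom) (k.hom.app _ z) ∈ J d) : ∃ l, l ≫ j = k := by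
  have := isIso_of_mono_of_locallySurjective (pullback.snd j k)
    (jointlyLocallySurjective_pullback (n := fun _ : Unit => j) h)
  exact ⟨inv (pullback.snd j k) ≫ pullback.fst j k, by
    rw [Category.assoc, pullback.condition, IsIso.inv_hom_id_assoc]⟩

/-- The sections of a union of subobjects belong locally to these subobjects. -/
lemma jointImageSieve_mem_of_isLUB {X W : Sheaf J (Type u)} {T : Set (Subobject X)} (w : W ⟶ X)
    [Mono w] (hT : IsLUB T (Subobject.mk w)) {d : D} (s : W.obj.obj (op d)) :
    jointImageSieve (fun t : T => t.1.arrow.hom) (w.hom.app _ s) ∈ J d := by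
  let R : Subfunctor X.obj := ⨆ t : T, Subfunctor.range t.1.arrow.hom
  have hX := (isSheaf_iff_isSheaf_of_type _ _).1 X.property
  let B : Sheaf J (Type u) := ⟨(R.sheafify J).toFunctor,
    (isSheaf_iff_isSheaf_of_type _ _).2 (R.sheafify_isSheaf hX)⟩
  let j : B ⟶ X := ⟨(R.sheafify J).ι⟩
  have : Mono j := (sheafToPresheaf J _).mono_of_mono_map
    (inferInstanceAs (Mono (R.sheafify J).ι))
  have hle : Subobject.mk w ≤ Subobject.mk j := by
    refine hT.2 fun t ht => ?_
    have h : Subfunctor.range t.arrow.hom ≤ R.sheafify J :=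
      (le_iSup (fun t : T => Subfunctor.range t.1.arrow.hom) ⟨t, ht⟩).trans (R.le_sheafify J)
    let l : (t : Sheaf J (Type u)) ⟶ B := ⟨Subfunctor.lift t.arrow.hom h⟩
    refine Subobject.le_mk_of_comm l ?_
    ext1
    exact Subfunctor.lift_ι _ h
  have hs := congrArg (fun f : W ⟶ X => f.hom.app _ s) (Subobject.ofMkLEMk_comp hle)
  have hmem : R.sieveOfSection (w.hom.app _ s) ∈ J d := by
    dsimp only at hs
    rw [← hs]
    exact ((Subobject.ofMkLEMk w j hle).hom.app _ s).2
  refine J.superset_covering ?_ hmem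
  intro e f hf
  obtain ⟨t, y, hy⟩ : ∃ t : T, X.obj.map f.op (w.hom.app _ s) ∈
      (Subfunctor.range t.1.arrow.hom).obj (op e) := by
    simpa only [R, Subfunctor.iSup_obj, Set.mem_iUnion] using
      (show X.obj.map f.op (w.hom.app _ s) ∈ R.obj (op e) from hf)
  exact ⟨t, y, hy⟩

/-- A morphism from a prime object whose sections lift locally along the members of a family of
monomorphisms factors through a member of the family. -/
lemma IsPrimeObject.exists_comp_eq {A X : Sheaf J (Type u)} (hA : IsPrimeObject A) {ι : Type*}
    {U : ι → Sheaf J (Type u)} (n : ∀ i, U i ⟶ X) [∀ i, Mono (n i)] (k : A ⟶ X)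
    (h : ∀ d (z : A.obj.obj (op d)),
      jointImageSieve (fun i => (n i).hom) (k.hom.app _ z) ∈ J d) : ∃ i l, l ≫ n i = k := by
  have hl := (jointlyLocallySurjective_pullback h).jointlyExtremal_of_sheaf.isLUB (𝟙 A)
    (fun i => pullback.snd (n i) k) fun i => Category.comp_id _
  rw [← Subobject.top_eq_id] at hl
  obtain ⟨i, hi⟩ := hA _ hl
  have := (Subobject.isIso_iff_mk_eq_top _).2 hi
  exact ⟨i, inv (pullback.snd (n i) k) ≫ pullback.fst (n i) k, by
    rw [Category.assoc, pullback.condition, IsIso.inv_hom_id_assoc]⟩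

lemma IsPrimeObject.exists_factors {A X : Sheaf J (Type u)} (hA : IsPrimeObject A)
    {T : Set (Subobject X)} {w : Subobject X} (hT : IsLUB T w) (k : A ⟶ X) (hk : w.Factors k) :
    ∃ t ∈ T, t.Factors k := by
  obtain ⟨⟨t, ht⟩, l, hl⟩ := hA.exists_comp_eq (fun t : T => t.1.arrow) k fun d z => by
    rw [← Subobject.mk_arrow w] at hT
    rw [← w.factorThru_arrow k hk]
    exact jointImageSieve_mem_of_isLUB w.arrow hT ((w.factorThru k hk).hom.app _ z)
  exact ⟨t, ht, (Subobject.factors_iff _ _).2 ⟨l, hl⟩⟩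

end Primes

/-! ### Chain conditions and intersections of filters -/

section Chains

/-- Every linear order has a well-ordered cofinal subset. -/
lemma exists_wellFoundedLT_isCofinal (α : Type*) [LinearOrder α] :
    ∃ s : Set α, IsCofinal s ∧ WellFoundedLT s := by
  refine ⟨_, isCofinal_setOfPred_imp_lt (WellOrderingRel (α := α)), ⟨?_⟩⟩
  refine Subrelation.wf (r := fun a b => WellOrderingRel a.1 b.1) (fun {a b} hab => ?_)
    (InvImage.wf Subtype.val WellOrderingRel.isWellOrder.wf)
  by_contra h
  rcases trichotomous_of (WellOrderingRel (α := α)) a.1 b.1 with h' | h' | h'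
  · exact h h'
  · exact hab.ne (Subtype.ext h')
  · exact lt_asymm hab (a.2 _ h')

variable {C : Type u} [SmallCategory C] [CoherentCategory C]

/-- The union of a chain of prime filters is a prime filter. -/
lemma PrimeFilter.exists_mem_iff_of_isChain {x : C} {c : Set (PrimeFilter x)}
    (hc : IsChain (· ≤ ·) c) (hne : c.Nonempty) :
    ∃ p : PrimeFilter x, ∀ w, w ∈ p.1 ↔ ∃ q ∈ c, w ∈ q.1 := by
  obtain ⟨q₀, hq₀⟩ := hne
  refine ⟨ofSet {w | ∃ q ∈ c, w ∈ q.1} ⟨q₀, hq₀, Order.PFilter.top_mem⟩ ?_ ?_ ?_ ?_,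
    fun _ => Iff.rfl⟩
  · rintro a b hab ⟨q, hq, ha⟩
    exact ⟨q, hq, q.1.mem_of_le hab ha⟩
  · rintro a b ⟨q, hq, ha⟩ ⟨r, hr, hb⟩
    rcases hc.total hq hr with h | h
    · exact ⟨r, hr, Order.PFilter.inf_mem (h ha) hb⟩
    · exact ⟨q, hq, Order.PFilter.inf_mem ha (h hb)⟩
  · obtain ⟨w, hw⟩ := CoherentCategory.exists_isBot x
    exact ⟨w, fun ⟨q, _, h⟩ => q.not_mem_of_isBot hw h⟩
  · intro a b
    obtain ⟨w, hw⟩ := CoherentCategory.exists_isLUB a b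
    refine ⟨w, hw.1 (by simp), hw.1 (by simp), fun ⟨q, hq, h⟩ => ?_⟩
    exact (q.mem_or_mem hw h).imp (fun h => ⟨q, hq, h⟩) (fun h => ⟨q, hq, h⟩)

variable {E : Type u₁} [Category.{v₁} E]

/-- The filters `q` for which `k` factors through `M(#Y(x, q))` are closed under unions of arbitrary
chains, since a chain has a well-ordered cofinal subset. -/
lemma IsPInfLexCocontinuous.exists_factorization {M : SpecTopos C ⥤ E}
    (hM : IsPInfLexCocontinuous C M) {x : C} {c : Set (PrimeFilter x)}
    (hc : IsChain (· ≤ ·) c) {pinf : PrimeFilter x}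
    (hp : ∀ w, w ∈ pinf.1 ↔ ∃ q ∈ c, w ∈ q.1) {Z : E} (k : Z ⟶ M.obj ((phi C).obj x))
    (hk : ∀ q ∈ c, ∃ l, l ≫ M.map (sheafInclusion (Spec.mk x q)) = k) :
    ∃ l, l ≫ M.map (sheafInclusion (Spec.mk x pinf)) = k := by
  have := hM.lex
  classical
  let _ : LinearOrder c := hc.linearOrder
  obtain ⟨s, hs, _⟩ := exists_wellFoundedLT_isCofinal c
  let p : s →o PrimeFilter x := ⟨fun q => q.1.1, fun _ _ h => h⟩
  have h (i : s) : p i ≤ pinf := fun w hw => (hp w).2 ⟨_, i.1.2, hw⟩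
  have hp' (w : Subobject x) : w ∈ pinf.1 ↔ ∃ i, w ∈ (p i).1 := by
    refine ⟨fun hw => ?_, fun ⟨i, hi⟩ => h i hi⟩
    obtain ⟨q, hq, hw⟩ := (hp w).1 hw
    obtain ⟨r, hr, hqr⟩ := hs ⟨q, hq⟩
    exact ⟨⟨r, hr⟩, hqr hw⟩
  obtain ⟨hlim⟩ := hM.chain p pinf h hp'
  choose l hl using fun i : s => hk _ i.1.2
  have hcomp {i j : s} (hij : i ≤ j) :
      l j ≫ M.map ((sheafYoneda C).map (Spec.idOfLE (p.monotone hij))) = l i := by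
    have := mono_map_sheafInclusion M (Spec.mk x (p i))
    refine (cancel_mono (M.map (sheafInclusion (Spec.mk x (p i))))).1 ?_
    rw [Category.assoc, ← M.map_comp, sheafYoneda_map_idOfLE_comp]
    exact (hl j).trans (hl i).symm
  let cone : Cone (chainDiagram p ⋙ sheafYoneda C ⋙ M) :=
    { pt := Z
      π :=
        { app := fun i => l i.unop
          naturality := fun i j f => (Category.id_comp _).trans (hcomp f.unop.le).symm } }
  obtain ⟨i₀, -⟩ := (hp' ⊤).1 Order.PFilter.top_mem
  refine ⟨hlim.lift cone, ?_⟩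
  have hfac : hlim.lift cone ≫ M.map ((sheafYoneda C).map (Spec.idOfLE (h i₀))) = l i₀ :=
    hlim.fac cone (op i₀)
  have h₀ : M.map (sheafInclusion (Spec.mk x pinf)) =
      M.map ((sheafYoneda C).map (Spec.idOfLE (h i₀))) ≫
        M.map (sheafInclusion (Spec.mk x (p i₀))) :=
    (congrArg M.map (sheafYoneda_map_idOfLE_comp (h i₀)).symm).trans (M.map_comp _ _)
  exact (congrArg (hlim.lift cone ≫ ·) h₀).trans ((Category.assoc _ _ _).symm.trans
    ((congrArg (· ≫ M.map (sheafInclusion (Spec.mk x (p i₀)))) hfac).trans (hl i₀)))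

variable {D : Type u} [SmallCategory D] {J : GrothendieckTopology D}

/-- A prime of `M(φ x)` is contained in some `M(#Y(x, q))`, and the prime filter of all `w` whose
image `M(φ w)` contains it is the largest such `q`. -/
lemma IsPInfLexCocontinuous.exists_comp_eq_of_isPrimeObject {M : SpecTopos C ⥤ Sheaf J (Type u)}
    (hM : IsPInfLexCocontinuous C M) (a : Spec C) {A : Sheaf J (Type u)} (hA : IsPrimeObject A)
    (k : A ⟶ M.obj ((phi C).obj a.pt))
    (hk : ∀ w ∈ a.filter.1, ∃ l : A ⟶ M.obj ((phi C).obj (w : C)),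
      l ≫ M.map ((phi C).map w.arrow) = k) :
    ∃ l : A ⟶ M.obj ((sheafYoneda C).obj a), l ≫ M.map (sheafInclusion a) = k := by
  have := hM.lex
  have := hM.cocontinuous
  obtain ⟨x, p⟩ := a
  let n (q : PrimeFilter x) : M.obj ((sheafYoneda C).obj (Spec.mk x q)) ⟶ M.obj ((phi C).obj x) :=
    M.map (sheafInclusion (Spec.mk x q))
  have hn (q : PrimeFilter x) : Mono (n q) := mono_map_sheafInclusion M (Spec.mk x q)
  let Q : Set (PrimeFilter x) := {q | ∃ l, l ≫ n q = k}
  obtain ⟨q₀, hq₀⟩ : Q.Nonempty := by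
    have h := ((jointlyLocallySurjective_germInclusion x).jointlyExtremal M).isLUB (𝟙 _) n
      (fun _ => Category.comp_id _) hn
    obtain ⟨_, ⟨q, rfl⟩, hq⟩ := hA.exists_factors h k
      ((Subobject.mk_factors_iff _ _).2 ⟨k, Category.comp_id k⟩)
    exact ⟨q, (Subobject.mk_factors_iff _ _).1 hq⟩
  obtain ⟨q, -, hq⟩ := zorn_le_nonempty₀ Q (fun c hcQ hc r hr => by
    obtain ⟨pinf, hp⟩ := PrimeFilter.exists_mem_iff_of_isChain hc ⟨r, hr⟩
    exact ⟨pinf, hM.exists_factorization hc hp k fun q hq => hcQ hq,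
      fun q hq w hw => (hp w).2 ⟨q, hq, hw⟩⟩) q₀ hq₀
  -- By maximality, `q` contains every `w` such that `k` factors through `M(φ w)`.
  have hpq : p ≤ q := by
    intro w hw
    obtain ⟨l, hl⟩ := hq.1
    obtain ⟨l', hl'⟩ := hk w hw
    let G := presheafToSheaf (topology C) (Type u) ⋙ M
    let i := germInclusion (Spec.mk x q)
    let j := (germFunctor C).map w.arrow
    have hpb : IsPullback (G.map (pullback.fst i j)) (G.map (pullback.snd i j)) (G.map i)
      (G.map j) := (IsPullback.of_hasPullback i j).map G
    have hG : PreservesFiniteLimits G := comp_preservesFiniteLimits _ _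
    have h := ((jointlyLocallySurjective_inter q w).jointlyExtremal M).isLUB
      (G.map (pullback.fst i j ≫ i)) (fun r => n r.1)
      (fun r => (G.map_comp _ _).symm.trans (congrArg G.map ((pullback.lift_fst_assoc _ _ _ _).trans
        (yoneda_map_idOfLE_comp r.2.1)))) fun r => hn r.1
    obtain ⟨_, ⟨r, rfl⟩, hr⟩ := hA.exists_factors h k ((Subobject.mk_factors_iff _ _).2
      ⟨hpb.lift l l' (hl.trans hl'.symm), by
        refine (congrArg (_ ≫ ·) (G.map_comp _ _)).trans ?_
        exact (hpb.lift_fst_assoc _ _ _ _).trans hl⟩)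
    exact hq.2 ((Subobject.mk_factors_iff _ _).1 hr) r.2.1 r.2.2
  obtain ⟨l, hl⟩ := hq.1
  refine ⟨l ≫ M.map ((sheafYoneda C).map (Spec.idOfLE hpq)), ?_⟩
  rw [Category.assoc, ← M.map_comp, sheafYoneda_map_idOfLE_comp, hl]

/-- If the primes generate, the chain condition implies that intersections over arbitrary prime
filters are preserved. -/
theorem IsPInfLexCocontinuous.preservesFilterInter (hJ : IsPrimeGenerated (Sheaf J (Type u)))
    {M : SpecTopos C ⥤ Sheaf J (Type u)} (hM : IsPInfLexCocontinuous C M) :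
    PreservesFilterInter M := by
  intro a Z k hk
  have := hM.lex
  obtain ⟨S, hS, hlub⟩ := hJ Z
  have hfac : (⊤ : Subobject Z) ≤
      (Subobject.pullback k).obj (Subobject.mk (M.map (sheafInclusion a))) := by
    refine hlub.2 fun t ht => ?_
    obtain ⟨l, hl⟩ := hM.exists_comp_eq_of_isPrimeObject a (hS t ht).isPrimeObject (t.arrow ≫ k)
      fun w hw => by
        obtain ⟨l, hl⟩ := hk w hw
        exact ⟨t.arrow ≫ l, by rw [Category.assoc, hl]⟩
    have hpb := Subobject.isPullback k (Subobject.mk (M.map (sheafInclusion a)))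
    have hf : (Subobject.mk (M.map (sheafInclusion a))).Factors (t.arrow ≫ k) :=
      (Subobject.mk_factors_iff _ _).2 ⟨l, hl⟩
    exact Subobject.le_of_comm (hpb.lift (Subobject.factorThru _ _ hf) t.arrow
      (Subobject.factorThru_arrow _ _ hf)) (hpb.lift_snd _ _ _)
  have hpb := Subobject.isPullback k (Subobject.mk (M.map (sheafInclusion a)))
  have hf : (Subobject.mk (M.map (sheafInclusion a))).Factors k := by
    refine (Subobject.factors_iff _ _).2 ⟨inv (⊤ : Subobject Z).arrow ≫
      Subobject.ofLE _ _ hfac ≫ Subobject.pullbackπ k _, ?_⟩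
    change (_ ≫ _ ≫ _) ≫ (Subobject.mk (M.map (sheafInclusion a))).arrow = k
    rw [Category.assoc, Category.assoc, hpb.w, Subobject.ofLE_arrow_assoc,
      IsIso.inv_hom_id_assoc]
  exact (Subobject.mk_factors_iff _ _).1 hf

end Chains

/-! ### The topology of locally surjective sieves on a topos of sheaves -/

section SheafTopology

variable {D : Type u} [SmallCategory D]

/-- The topology on a topos of sheaves for which a sieve covers `X` if every section of `X` lifts,
locally, along some member of the sieve. -/
def sheafTopology (J : GrothendieckTopology D) : GrothendieckTopology (Sheaf J (Type u)) where
  sieves X := {S | JointlyLocallySurjective J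
    fun i : Σ Z, {g : Z ⟶ X // S g} => i.2.1.hom}
  top_mem' X := .of_forall_exists fun d s => ⟨⟨X, 𝟙 X, trivial⟩, s, rfl⟩
  pullback_stable' X Y S f hS d s := by
    refine J.superset_covering ?_ (hS (f.hom.app _ s))
    rintro e g ⟨⟨Z, k, hk⟩, t, ht⟩
    let σ : (presheafToSheaf J (Type u)).obj (yoneda.obj e) ⟶ Y :=
      sectionEquiv.symm (Y.obj.map g.op s)
    refine ⟨⟨_, σ, ?_⟩, sectionEquiv (𝟙 _), ?_⟩
    · change S (σ ≫ f)
      have h : σ ≫ f = sectionEquiv.symm t ≫ k := by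
        rw [sectionEquiv_symm_comp, sectionEquiv_symm_comp, ht, NatTrans.naturality_apply]
      exact h ▸ S.downward_closed hk _
    · rw [← sectionEquiv_comp, Category.id_comp, Equiv.apply_symm_apply]
  transitive' X S hS R hR d s := by
    refine J.transitive (hS s) _ ?_
    rintro e f ⟨⟨Z, g, hg⟩, t, ht⟩
    refine J.superset_covering ?_ (hR hg t)
    rintro e' f' ⟨⟨Z', g', hg'⟩, t', ht'⟩
    refine ⟨⟨Z', g' ≫ g, hg'⟩, t', ?_⟩
    change g.hom.app _ (g'.hom.app _ t') = _
    dsimp only at ht ht'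
    rw [ht', NatTrans.naturality_apply, ht, op_comp, Functor.map_comp_apply]

variable {J : GrothendieckTopology D}

lemma mem_sheafTopology_iff {X : Sheaf J (Type u)} {S : Sieve X} :
    S ∈ sheafTopology J X ↔ JointlyLocallySurjective J
      fun i : Σ Z, {g : Z ⟶ X // S g} => i.2.1.hom := Iff.rfl

/-- Compatible families on a covering sieve glue: the value on a section is obtained by gluing the
values on its local lifts. -/
lemma isSheaf_yoneda_sheafTopology (Y : Sheaf J (Type u)) :
    Presieve.IsSheaf (sheafTopology J) (yoneda.obj Y) := by
  intro X S hS x hx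
  have hY := (isSheaf_iff_isSheaf_of_type _ _).1 Y.property
  rw [mem_sheafTopology_iff] at hS
  have key {e : D} {Z Z' : Sheaf J (Type u)} {g : Z ⟶ X} {g' : Z' ⟶ X} (hg : S g) (hg' : S g')
      (t : Z.obj.obj (op e)) (t' : Z'.obj.obj (op e)) (h : g.hom.app _ t = g'.hom.app _ t') :
      (x g hg).hom.app _ t = (x g' hg').hom.app _ t' := by
    have := hx (sectionEquiv.symm t) (sectionEquiv.symm t') hg hg' (by
      rw [sectionEquiv_symm_comp, sectionEquiv_symm_comp, h])
    change sectionEquiv.symm t ≫ x g hg = sectionEquiv.symm t' ≫ x g' hg' at this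
    rw [sectionEquiv_symm_comp, sectionEquiv_symm_comp] at this
    exact sectionEquiv.symm.injective this
  let G {d : D} (s : X.obj.obj (op d)) (y : Y.obj.obj (op d)) : Prop :=
    ∀ ⦃e : D⦄ (f : e ⟶ d) ⦃Z : Sheaf J (Type u)⦄ (g : Z ⟶ X) (hg : S g) (t : Z.obj.obj (op e)),
      g.hom.app _ t = X.obj.map f.op s → (x g hg).hom.app _ t = Y.obj.map f.op y
  have hG_ext {d : D} {s : X.obj.obj (op d)} {y y' : Y.obj.obj (op d)} (h : G s y) (h' : G s y') :
      y = y' := by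
    refine (hY.isSeparated _ (hS s)).ext ?_
    rintro e f ⟨⟨Z, g, hg⟩, t, ht⟩
    exact (h f g hg t ht).symm.trans (h' f g hg t ht)
  have hG (d : D) (s : X.obj.obj (op d)) : ∃ y, G s y := by
    have hlift (e : D) (f : e ⟶ d) (hf : jointImageSieve
        (fun i : Σ Z, {g : Z ⟶ X // S g} => i.2.1.hom) s f) :
        ∃ (Z : Sheaf J (Type u)) (g : Z ⟶ X) (_ : S g) (t : Z.obj.obj (op e)),
          g.hom.app _ t = X.obj.map f.op s := by
      obtain ⟨⟨Z, g, hg⟩, t, ht⟩ := hf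
      exact ⟨Z, g, hg, t, ht⟩
    choose Z g hg t ht using hlift
    let fam : Presieve.FamilyOfElements Y.obj (jointImageSieve
        (fun i : Σ Z, {g : Z ⟶ X // S g} => i.2.1.hom) s).arrows :=
      fun e f hf => (x _ (hg e f hf)).hom.app _ (t e f hf)
    have hfam : fam.Compatible := by
      intro e₁ e₂ e g₁ g₂ f₁ f₂ hf₁ hf₂ h
      rw [← NatTrans.naturality_apply, ← NatTrans.naturality_apply]
      refine key _ _ _ _ ?_
      rw [NatTrans.naturality_apply, NatTrans.naturality_apply, ht, ht, ← Functor.map_comp_apply,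
        ← Functor.map_comp_apply, ← op_comp, ← op_comp, h]
    obtain ⟨y, hy, -⟩ := hY _ (hS s) fam hfam
    refine ⟨y, fun e f Z' g' hg' t' ht' => ?_⟩
    have hf : jointImageSieve (fun i : Σ Z, {g : Z ⟶ X // S g} => i.2.1.hom) s f :=
      ⟨⟨Z', g', hg'⟩, t', ht'⟩
    rw [hy f hf]
    exact key _ _ _ _ (ht'.trans (ht e f hf).symm)
  choose y hy using hG
  let k : X ⟶ Y := ⟨{ app := fun d => TypeCat.ofHom (y d.unop)
                      naturality := fun d e f => by
                        ext s
                        refine hG_ext (hy _ (X.obj.map f s)) fun e' f' Z g hg t ht => ?_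
                        have := hy _ s (f' ≫ f.unop) g hg t (by
                          rw [ht, op_comp, Functor.map_comp_apply]
                          rfl)
                        rw [this, op_comp, Functor.map_comp_apply]
                        rfl }⟩
  have hk {Z : Sheaf J (Type u)} (g : Z ⟶ X) (hg : S g) : g ≫ k = x g hg := by
    ext d t
    refine Eq.symm ((hy d.unop (g.hom.app _ t) (𝟙 _) g hg t ?_).trans ?_)
    · rw [op_id, Functor.map_id_apply]
    · rw [op_id, Functor.map_id_apply]
      rfl
  have huniq (k' : X ⟶ Y) (h : ∀ (Z : Sheaf J (Type u)) (g : Z ⟶ X) (hg : S g),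
      g ≫ k' = x g hg) : k' = k := by
    ext1
    refine hS.hom_ext Y.property fun i => ?_
    exact congrArg (·.hom) ((h _ i.2.1 i.2.2).trans (hk i.2.1 i.2.2).symm)
  exact ⟨k, fun Z g hg => hk g hg, fun k' hk' => huniq k' hk'⟩

instance : (sheafTopology J).Subcanonical :=
  .of_isSheaf_yoneda_obj _ isSheaf_yoneda_sheafTopology

variable (J) in
/-- The morphisms between representables, as sections of their sheafifications. -/
def toSection {d e : D} (h : e ⟶ d) :
    ((presheafToSheaf J (Type u)).obj (yoneda.obj d)).obj.obj (op e) :=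
  (toSheafify J (yoneda.obj d)).app (op e) h

lemma sectionEquiv_map {d e : D} (h : e ⟶ d) :
    sectionEquiv ((presheafToSheaf J (Type u)).map (yoneda.map h)) = toSection J h := by
  refine Eq.trans (congrArg yonedaEquiv (Adjunction.homEquiv_unit _ _ _ _)) ?_
  refine Eq.trans (congrArg yonedaEquiv ((sheafificationAdjunction J (Type u)).unit.naturality
    (yoneda.map h)).symm) ?_
  rw [yonedaEquiv_comp]
  exact congrArg _ (yonedaEquiv_yoneda_map h)

lemma sectionEquiv_symm_app_toSection {d e : D} {X : Sheaf J (Type u)} (s : X.obj.obj (op d))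
    (h : e ⟶ d) : (sectionEquiv.symm s).hom.app _ (toSection J h) = X.obj.map h.op s := by
  rw [← sectionEquiv_map, ← sectionEquiv_comp, sectionEquiv_map_comp, Equiv.apply_symm_apply]

lemma map_toSection {d e e' : D} (h : e ⟶ d) (g : e' ⟶ e) :
    ((presheafToSheaf J (Type u)).obj (yoneda.obj d)).obj.map g.op (toSection J h) =
      toSection J (g ≫ h) :=
  (NatTrans.naturality_apply (toSheafify J (yoneda.obj d)) g.op h).symm

lemma exists_toSection_eq {d e : D}
    (s : ((presheafToSheaf J (Type u)).obj (yoneda.obj d)).obj.obj (op e)) :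
    ∃ S ∈ J e, ∀ ⦃e' : D⦄ (g : e' ⟶ e), S g → ∃ h : e' ⟶ d, toSection J h =
      ((presheafToSheaf J (Type u)).obj (yoneda.obj d)).obj.map g.op s :=
  ⟨Presheaf.imageSieve (toSheafify J (yoneda.obj d)) s, Presheaf.imageSieve_mem J _ _,
    fun _ _ ⟨h, hh⟩ => ⟨h, hh⟩⟩

lemma exists_comp_eq_of_toSection_eq {d e : D} {h h' : e ⟶ d} (H : toSection J h = toSection J h') :
    ∃ S ∈ J e, ∀ ⦃e' : D⦄ (g : e' ⟶ e), S g → g ≫ h = g ≫ h' :=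
  ⟨Presheaf.equalizerSieve (F := yoneda.obj d) (X := op e) h h',
    Presheaf.equalizerSieve_mem J (toSheafify J (yoneda.obj d)) (X := op e) h h' H,
    fun _ _ hg => hg⟩

end SheafTopology

/-! ### A topos of sheaves as the sheaves on itself -/

section Density

variable {D : Type u} [SmallCategory D] (J : GrothendieckTopology D)

/-- The sheafified Yoneda embedding. -/
abbrev yonedaSheaf : D ⥤ Sheaf J (Type u) := yoneda ⋙ presheafToSheaf J (Type u)

variable {J}

/-- A section lifts along an arrow of a pushforward sieve if and only if it lifts along the image of
an arrow of the sieve. -/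
lemma jointImageSieve_functorPushforward {B : Type u₁} [Category.{v₁} B]
    (H : B ⥤ Sheaf J (Type u)) {b : B} (S : Sieve b) {d : D} (s : (H.obj b).obj.obj (op d))
    {e : D} (f : e ⟶ d) :
    jointImageSieve (fun i : Σ Z, {g : Z ⟶ H.obj b // S.functorPushforward H g} => i.2.1.hom) s f ↔
      ∃ (c : B) (g : c ⟶ b) (_ : S g) (t : (H.obj c).obj.obj (op e)),
        (H.map g).hom.app _ t = (H.obj b).obj.map f.op s := by
  constructor
  · rintro ⟨⟨Z, g, hg⟩, t, ht⟩
    obtain ⟨c, h, k, hS, e'⟩ := Presieve.getFunctorPushforwardStructure hg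
    refine ⟨c, h, hS, k.hom.app _ t, ?_⟩
    rw [← ht]
    exact congrArg (fun f : Z ⟶ H.obj b => f.hom.app _ t) e'.symm
  · rintro ⟨c, g, hg, t, ht⟩
    exact ⟨⟨_, H.map g, Sieve.image_mem_functorPushforward H S hg⟩, t, ht⟩

lemma map_yonedaSheaf_toSection {d e e' : D} (h : e' ⟶ e) (g : e ⟶ d) :
    ((yonedaSheaf J).map g).hom.app _ (toSection J h) = toSection J (h ≫ g) := by
  rw [← sectionEquiv_map, ← sectionEquiv_map, ← sectionEquiv_comp, yoneda.map_comp,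
    Functor.map_comp]
  rfl

lemma functorPushforward_yonedaSheaf_mem {d : D} {R : Sieve d} (hR : R ∈ J d) :
    R.functorPushforward (yonedaSheaf J) ∈ sheafTopology J ((yonedaSheaf J).obj d) := by
  intro e s
  obtain ⟨S, hS, h⟩ := exists_toSection_eq s
  refine J.transitive hS _ fun e' g hg => ?_
  obtain ⟨k, hk⟩ := h g hg
  refine J.superset_covering ?_ (J.pullback_stable k hR)
  intro e'' r hr
  refine (jointImageSieve_functorPushforward (yonedaSheaf J) R s (r ≫ g)).2
    ⟨e'', r ≫ k, hr, toSection J (𝟙 e''), ?_⟩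
  rw [map_yonedaSheaf_toSection, Category.id_comp, op_comp, Functor.map_comp_apply]
  refine (map_toSection k r).symm.trans ?_
  rw [hk]
  rfl

lemma mem_of_functorPushforward_yonedaSheaf_mem {d : D} {R : Sieve d}
    (hR : R.functorPushforward (yonedaSheaf J) ∈ sheafTopology J ((yonedaSheaf J).obj d)) :
    R ∈ J d := by
  refine J.transitive (hR (toSection J (𝟙 d))) _ fun e f hf => ?_
  obtain ⟨c, r, hr, t, ht⟩ := (jointImageSieve_functorPushforward (yonedaSheaf J) R _ f).1 hf
  obtain ⟨S, hS, h⟩ := exists_toSection_eq t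
  refine J.transitive hS _ fun e' g hg => ?_
  obtain ⟨k, hk⟩ := h g hg
  have h₁ : toSection J (k ≫ r) = toSection J (g ≫ f) := by
    rw [← map_yonedaSheaf_toSection, hk, ← Category.comp_id (g ≫ f), ← map_toSection, op_comp,
      Functor.map_comp_apply]
    refine (NatTrans.naturality_apply ((yonedaSheaf J).map r).hom g.op t).trans ?_
    rw [ht]
    rfl
  obtain ⟨S', hS', h'⟩ := exists_comp_eq_of_toSection_eq h₁
  refine J.superset_covering (fun e'' g' hg' => ?_) hS'
  change R ((g' ≫ g) ≫ f)
  rw [Category.assoc, ← h' g' hg', ← Category.assoc]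
  exact R.downward_closed hr _

/-- Sections of sheaves are morphisms from sheafified representables, and locally these come from
the site. -/
instance : (yonedaSheaf J).IsDenseSubsite J (sheafTopology J) where
  isCoverDense' := ⟨fun X => JointlyLocallySurjective.of_forall_exists fun d s =>
    ⟨⟨_, sectionEquiv.symm s, Presieve.in_coverByImage (yonedaSheaf J) _⟩, sectionEquiv (𝟙 _), by
      rw [← sectionEquiv_comp, Category.id_comp, Equiv.apply_symm_apply]⟩⟩
  isLocallyFull' := ⟨fun {d d'} f => by
    obtain ⟨S, hS, h⟩ := exists_toSection_eq (sectionEquiv f)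
    refine GrothendieckTopology.superset_covering _ (Sieve.functorPushforward_monotone _ _
      fun e g hg => ?_) (functorPushforward_yonedaSheaf_mem hS)
    obtain ⟨k, hk⟩ := h g hg
    refine ⟨k, sectionEquiv.injective ?_⟩
    exact (sectionEquiv_map k).trans (hk.trans (sectionEquiv_map_comp g f).symm)⟩
  isLocallyFaithful' := ⟨fun {d d'} f f' hff => by
    obtain ⟨S, hS, h⟩ := exists_comp_eq_of_toSection_eq (J := J) (h := f) (h' := f')
      ((sectionEquiv_map f).symm.trans ((congrArg sectionEquiv hff).trans (sectionEquiv_map f')))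
    exact GrothendieckTopology.superset_covering _ (Sieve.functorPushforward_monotone _ _
      fun e g hg => h g hg) (functorPushforward_yonedaSheaf_mem hS)⟩
  functorPushforward_mem_iff :=
    ⟨mem_of_functorPushforward_yonedaSheaf_mem, functorPushforward_yonedaSheaf_mem⟩

variable (J) in
/-- Restricting a representable sheaf on a topos of sheaves along the sheafified Yoneda embedding
gives back the representing object. -/
def yonedaCompPushforwardIso : (sheafTopology J).yoneda ⋙
    (yonedaSheaf J).sheafPushforwardContinuous (Type u) J (sheafTopology J) ≅ 𝟭 _ :=
  NatIso.ofComponents (fun X => (fullyFaithfulSheafToPresheaf J (Type u)).preimageIso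
    (NatIso.ofComponents (fun d => (sectionEquiv (d := d.unop) (X := X)).toIso) (by
      intro d e g
      ext s
      exact sectionEquiv_map_comp g.unop s))) (by
    intro X Y f
    ext d s
    exact sectionEquiv_comp s f)

/-- A topos of sheaves is equivalent to the category of sheaves on itself: restriction to the site
is an equivalence, with which the Yoneda embedding composes to the identity. -/
instance isEquivalence_yoneda_sheafTopology : (sheafTopology J).yoneda.IsEquivalence := by
  have : ((sheafTopology J).yoneda ⋙
      (yonedaSheaf J).sheafPushforwardContinuous (Type u) J (sheafTopology J)).IsEquivalence :=
    Functor.isEquivalence_of_iso (yonedaCompPushforwardIso J).symm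
  exact Functor.isEquivalence_of_comp_right _
    ((yonedaSheaf J).sheafPushforwardContinuous (Type u) J (sheafTopology J))

/-- The restriction of representable sheaves on a topos of sheaves to a small dense subsite is an
equivalence. -/
lemma isEquivalence_yoneda_comp_sheafPushforward {B : Type u} [SmallCategory B]
    (H : B ⥤ Sheaf J (Type u)) (K : GrothendieckTopology B) [H.IsDenseSubsite K (sheafTopology J)] :
    ((sheafTopology J).yoneda ⋙
      H.sheafPushforwardContinuous (Type u) K (sheafTopology J)).IsEquivalence :=
  inferInstance

end Density

/-! ### The site of prime elements of a coherent functor -/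

section PrimeSite

variable {D : Type u} [SmallCategory D] {J : GrothendieckTopology D}

instance small_subobject_sheaf (X : Sheaf J (Type u)) : Small.{u} (Subobject X) := by
  refine small_of_injective (β := Subfunctor X.obj)
    (f := fun t => Subfunctor.range t.arrow.hom) fun s t hst => ?_
  have key {s t : Subobject X}
      (h : Subfunctor.range s.arrow.hom ≤ Subfunctor.range t.arrow.hom) : s ≤ t := by
    obtain ⟨l, hl⟩ := exists_comp_eq_of_locally t.arrow s.arrow fun d z => by
      refine J.superset_covering (fun e f _ => ?_) (J.top_mem d)
      obtain ⟨y, hy⟩ := h (op d) ⟨z, rfl⟩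
      exact ⟨(), (t : Sheaf J (Type u)).obj.map f.op y, by rw [NatTrans.naturality_apply, hy]⟩
    exact Subobject.le_of_comm l hl
  exact le_antisymm (key (le_of_eq hst)) (key (le_of_eq hst.symm))

/-- A family of sheaves covers every sheaf if every section is locally the image of a section of a
member of the family. -/
def IsCoveringFamily {P : Type u} (A : P → Sheaf J (Type u)) : Prop :=
  ∀ X : Sheaf J (Type u), JointlyLocallySurjective J fun i : Σ p, A p ⟶ X => i.2.hom

/-- If the primes generate, then the primes contained in sheafified representables form a small
covering family. -/
lemma exists_isCoveringFamily (hJ : IsPrimeGenerated (Sheaf J (Type u))) :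
    ∃ (P : Type u) (A : P → Sheaf J (Type u)), (∀ p, IsPrimeObject (A p)) ∧
      IsCoveringFamily A := by
  choose S hS hlub using fun d : D => hJ ((yonedaSheaf J).obj d)
  let A (p : Σ d, Shrink.{u} (S d)) : Sheaf J (Type u) :=
    (((equivShrink (S p.1)).symm p.2).1 : Subobject _)
  refine ⟨_, A, fun p => (hS _ _ ((equivShrink (S p.1)).symm p.2).2).isPrimeObject, ?_⟩
  intro X d s
  have h := hlub d
  rw [Subobject.top_eq_id] at h
  refine J.superset_covering ?_ (jointImageSieve_mem_of_isLUB _ h (toSection J (𝟙 d)))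
  rintro e f ⟨t, y, hy⟩
  obtain ⟨p, hp⟩ : ∃ p, ((equivShrink (S d)).symm p) = t := ⟨equivShrink _ t, by simp⟩
  subst hp
  let t : Subobject ((yonedaSheaf J).obj d) := ((equivShrink (S d)).symm p).1
  change t.arrow.hom.app _ y = _ at hy
  refine ⟨⟨⟨d, p⟩, t.arrow ≫ sectionEquiv.symm s⟩, y, ?_⟩
  change (sectionEquiv.symm s).hom.app _ (t.arrow.hom.app _ y) = _
  rw [hy]
  exact (congrArg _ (map_toSection (J := J) (𝟙 d) f)).trans
    ((sectionEquiv_symm_app_toSection s (f ≫ 𝟙 d)).trans (by rw [Category.comp_id]))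

variable {C : Type u} [SmallCategory C] {P : Type u}

/-- The elements of a functor `F : C ⥤ Sh(D)`, defined on members of a family `A` of sheaves: the
category of triples `(p, x, h : A p ⟶ F x)`. -/
structure Elem (A : P → Sheaf J (Type u)) (F : C ⥤ Sheaf J (Type u)) : Type u where
  idx : P
  base : C
  hom : A idx ⟶ F.obj base

namespace Elem

variable {A : P → Sheaf J (Type u)} {F : C ⥤ Sheaf J (Type u)}

/-- Morphisms of elements. -/
@[ext]
structure Hom (δ ε : Elem A F) : Type u where
  left : A δ.idx ⟶ A ε.idx
  right : δ.base ⟶ ε.base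
  w : left ≫ ε.hom = δ.hom ≫ F.map right

instance : SmallCategory (Elem A F) where
  Hom := Hom
  id δ := ⟨𝟙 _, 𝟙 _, by simp⟩
  comp f g := ⟨f.left ≫ g.left, f.right ≫ g.right, by
    rw [Category.assoc, g.w, ← Category.assoc, f.w, Category.assoc, F.map_comp]⟩
  id_comp f := Hom.ext (Category.id_comp _) (Category.id_comp _)
  comp_id f := Hom.ext (Category.comp_id _) (Category.comp_id _)
  assoc f g h := Hom.ext (Category.assoc _ _ _) (Category.assoc _ _ _)

variable (A F) in
/-- The functor taking an element to the sheaf on which it is defined. -/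
def proj : Elem A F ⥤ Sheaf J (Type u) where
  obj δ := A δ.idx
  map f := f.left

section Density

variable [HasFiniteLimits C] [PreservesFiniteLimits F]

lemma exists_lift_prod (F : C ⥤ Sheaf J (Type u)) [PreservesFiniteLimits F] {x y : C}
    {Z : Sheaf J (Type u)} (a : Z ⟶ F.obj x) (b : Z ⟶ F.obj y) :
    ∃ m : Z ⟶ F.obj (x ⨯ y), m ≫ F.map prod.fst = a ∧ m ≫ F.map prod.snd = b := by
  obtain ⟨m, h₁, h₂⟩ :=
    BinaryFan.IsLimit.lift' (isLimitOfHasBinaryProductOfPreservesLimit F x y) a b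
  exact ⟨m, h₁, h₂⟩

lemma exists_lift_equalizer (F : C ⥤ Sheaf J (Type u)) [PreservesFiniteLimits F] {x y : C}
    (f g : x ⟶ y) {Z : Sheaf J (Type u)} (a : Z ⟶ F.obj x) (h : a ≫ F.map f = a ≫ F.map g) :
    ∃ m : Z ⟶ F.obj (equalizer f g), m ≫ F.map (equalizer.ι f g) = a :=
  ⟨Fork.IsLimit.lift (isLimitOfHasEqualizerOfPreservesLimit F f g) a h,
    Fork.IsLimit.lift_ι (isLimitOfHasEqualizerOfPreservesLimit F f g)⟩

/-- Replacing an element by its pair with a second one makes every morphism between the sheaves on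
which they are defined a morphism of elements. -/
lemma isLocallyFull_proj (K : GrothendieckTopology (Sheaf J (Type u))) :
    (proj A F).IsLocallyFull K where
  functorPushforward_imageSieve_mem {δ ε} f := by
    change A δ.idx ⟶ A ε.idx at f
    obtain ⟨m, h₁, h₂⟩ := exists_lift_prod F δ.hom (f ≫ ε.hom)
    let g : (⟨δ.idx, _, m⟩ : Elem A F) ⟶ δ := ⟨𝟙 _, prod.fst, by rw [h₁, Category.id_comp]⟩
    let k : (⟨δ.idx, _, m⟩ : Elem A F) ⟶ ε := ⟨f, prod.snd, h₂.symm⟩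
    have hg : (proj A F).imageSieve f g := ⟨k, (Category.id_comp f).symm⟩
    have := Sieve.image_mem_functorPushforward (proj A F) _ hg
    rw [Sieve.id_mem_iff_eq_top.1 this]
    exact K.top_mem _

/-- Two morphisms of elements with the same underlying morphism of sheaves agree on an element of an
equalizer. -/
lemma isLocallyFaithful_proj (K : GrothendieckTopology (Sheaf J (Type u))) :
    (proj A F).IsLocallyFaithful K where
  functorPushforward_equalizer_mem {δ ε} f f' hf := by
    change f.left = f'.left at hf
    obtain ⟨m, hm⟩ := exists_lift_equalizer F f.right f'.right δ.hom (by rw [← f.w, ← f'.w, hf])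
    let g : (⟨δ.idx, _, m⟩ : Elem A F) ⟶ δ := ⟨𝟙 _, equalizer.ι _ _, by rw [hm, Category.id_comp]⟩
    have hg : Sieve.equalizer f f' g := Hom.ext (congrArg (𝟙 _ ≫ ·) hf) (equalizer.condition _ _)
    have := Sieve.image_mem_functorPushforward (proj A F) _ hg
    rw [Sieve.id_mem_iff_eq_top.1 this]
    exact K.top_mem _

lemma isCoverDense_proj (hA : IsCoveringFamily A) : (proj A F).IsCoverDense (sheafTopology J) where
  is_cover X d s := by
    refine J.superset_covering ?_ (hA X s)
    rintro e f ⟨⟨p, k⟩, t, ht⟩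
    let δ : Elem A F := ⟨p, _, (isLimitOfHasTerminalOfPreservesLimit F).from (A p)⟩
    exact ⟨⟨A p, k, Presieve.in_coverByImage (proj A F) (Y := δ) k⟩, t, ht⟩

end Density

variable {K : GrothendieckTopology (Elem A F)}
  [(proj A F).IsDenseSubsite K (sheafTopology J)]

lemma mem_of_jointImageSieve_mem {δ : Elem A F} {S : Sieve δ}
    (h : ∀ d (s : (A δ.idx).obj.obj (op d)), jointImageSieve
      (fun i : Σ ε, {k : ε ⟶ δ // S k} => i.2.1.left.hom) s ∈ J d) : S ∈ K δ := by
  refine (Functor.functorPushforward_mem_iff K (sheafTopology J) (proj A F)).1 fun d s =>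
    J.superset_covering (fun e f => ?_) (h d s)
  rintro ⟨⟨ε, k, hk⟩, t, ht⟩
  exact (jointImageSieve_functorPushforward (proj A F) S s f).2 ⟨ε, k, hk, t, ht⟩

/-- A sieve containing a morphism that is the identity on the underlying sheaf covers. -/
lemma mem_of_left_eq_id {δ : Elem A F} {S : Sieve δ} {x : C} {m : A δ.idx ⟶ F.obj x}
    (g : (⟨δ.idx, x, m⟩ : Elem A F) ⟶ δ) (hg : g.left = 𝟙 _) (hS : S g) : S ∈ K δ :=
  mem_of_jointImageSieve_mem fun d s => by
    refine J.superset_covering (fun e f _ => ?_) (J.top_mem d)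
    refine ⟨⟨_, g, hS⟩, (A δ.idx).obj.map f.op s, ?_⟩
    dsimp only
    rw [hg]
    rfl

end Elem

end PrimeSite

/-! ### The prime filter of an element -/

section ElementFilter

variable {D : Type u} [SmallCategory D] {J : GrothendieckTopology D}
  {C : Type u} [SmallCategory C]
  {F : C ⥤ Sheaf J (Type u)}

lemma exists_comp_map_of_isPullback [PreservesFiniteLimits F] {W X Y Z : C} {fst : W ⟶ X}
    {snd : W ⟶ Y} {f : X ⟶ Z} {g : Y ⟶ Z} (h : IsPullback fst snd f g) {T : Sheaf J (Type u)}
    (a : T ⟶ F.obj X) (b : T ⟶ F.obj Y) (hab : a ≫ F.map f = b ≫ F.map g) :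
    ∃ l : T ⟶ F.obj W, l ≫ F.map fst = a ∧ l ≫ F.map snd = b :=
  ⟨(h.map F).lift a b hab, (h.map F).lift_fst _ _ _, (h.map F).lift_snd _ _ _⟩

variable [CoherentCategory C]

lemma Spec.homOf_comp {x y z : C} {p : PrimeFilter x} {q : PrimeFilter y} {r : PrimeFilter z}
    (f : x ⟶ y) (g : y ⟶ z) (hf : ∀ v ∈ q.1, (Subobject.pullback f).obj v ∈ p.1)
    (hg : ∀ v ∈ r.1, (Subobject.pullback g).obj v ∈ q.1)
    (hfg : ∀ v ∈ r.1, (Subobject.pullback (f ≫ g)).obj v ∈ p.1) :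
    Spec.homOf f hf ≫ Spec.homOf g hg = Spec.homOf (f ≫ g) hfg :=
  Subtype.ext ((Germ.comp_ofHom (q := q) (Spec.homOf f hf) g).trans (Germ.ofHom_postcomp f g))

/-- The prime filter of all subobjects `w` of `x` such that a given morphism `h : Z ⟶ F x`, with `Z`
prime, factors through `F w`. -/
def factorFilter (hF : IsCoherentFunctor F) {Z : Sheaf J (Type u)} (hZ : IsPrimeObject Z) {x : C}
    (h : Z ⟶ F.obj x) : PrimeFilter x :=
  have := hF.lex
  PrimeFilter.ofSet {w | ∃ l : Z ⟶ F.obj (w : C), l ≫ F.map w.arrow = h}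
    ⟨h ≫ F.map (inv (⊤ : Subobject x).arrow), by
      rw [Category.assoc, ← F.map_comp, IsIso.inv_hom_id, F.map_id, Category.comp_id]⟩
    (by
      rintro a b hab ⟨l, hl⟩
      exact ⟨l ≫ F.map (Subobject.ofLE a b hab), by
        rw [Category.assoc, ← F.map_comp, Subobject.ofLE_arrow, hl]⟩)
    (by
      rintro a b ⟨l, hl⟩ ⟨l', hl'⟩
      have hpb : IsPullback (Subobject.ofLE (a ⊓ b) a inf_le_left)
          (Subobject.ofLE (a ⊓ b) b inf_le_right) a.arrow b.arrow := by
        refine ⟨⟨by simp⟩, ⟨PullbackCone.IsLimit.mk _ (fun s => Subobject.factorThru _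
          (s.fst ≫ a.arrow) ((Subobject.inf_factors _).2 ⟨Subobject.factors_comp_arrow _, by
            rw [s.condition]; exact Subobject.factors_comp_arrow _⟩)) ?_ ?_ ?_⟩⟩
        · intro s
          rw [← cancel_mono a.arrow]
          simp
        · intro s
          rw [← cancel_mono b.arrow]
          simp [s.condition]
        · intro s m h₁ _
          rw [← cancel_mono (a ⊓ b).arrow, Subobject.factorThru_arrow, ← h₁]
          simp
      obtain ⟨m, hm, -⟩ := exists_comp_map_of_isPullback hpb l l' (hl.trans hl'.symm)
      exact ⟨m, by
        rw [← Subobject.ofLE_arrow (inf_le_left : a ⊓ b ≤ a), F.map_comp, ← Category.assoc, hm,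
          hl]⟩)
    (by
      obtain ⟨w, hw⟩ := CoherentCategory.exists_isBot x
      refine ⟨w, fun ⟨l, hl⟩ => ?_⟩
      obtain ⟨_, h₀, -⟩ := hZ.exists_factors (isLUB_empty_iff.2 (hF.isBot w hw)) h
        ((Subobject.mk_factors_iff _ _).2 ⟨l, hl⟩)
      exact h₀)
    (by
      intro a b
      obtain ⟨w, hw⟩ := CoherentCategory.exists_isLUB a b
      refine ⟨w, hw.1 (by simp), hw.1 (by simp), fun ⟨l, hl⟩ => ?_⟩
      obtain ⟨_, rfl | rfl, h⟩ := hZ.exists_factors (hF.isLUB a b w hw) h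
        ((Subobject.mk_factors_iff _ _).2 ⟨l, hl⟩)
      · exact Or.inl ((Subobject.mk_factors_iff _ _).1 h)
      · exact Or.inr ((Subobject.mk_factors_iff _ _).1 h))

lemma mem_factorFilter (hF : IsCoherentFunctor F) {Z : Sheaf J (Type u)} (hZ : IsPrimeObject Z)
    {x : C} (h : Z ⟶ F.obj x) (w : Subobject x) :
    w ∈ (factorFilter hF hZ h).1 ↔ ∃ l : Z ⟶ F.obj (w : C), l ≫ F.map w.arrow = h := Iff.rfl

/-- Along a morphism `f : x ⟶ y`, the filter of `h ≫ F f` is the inverse image of that of `h`. -/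
lemma pullback_mem_factorFilter (hF : IsCoherentFunctor F) {Z : Sheaf J (Type u)}
    (hZ : IsPrimeObject Z) {x y : C} (h : Z ⟶ F.obj x) (f : x ⟶ y) {w : Subobject y}
    {l : Z ⟶ F.obj (w : C)} (hl : l ≫ F.map w.arrow = h ≫ F.map f) :
    (Subobject.pullback f).obj w ∈ (factorFilter hF hZ h).1 := by
  have := hF.lex
  obtain ⟨m, -, hm⟩ := exists_comp_map_of_isPullback (Subobject.isPullback f w) l h hl
  exact ⟨m, hm⟩

namespace Elem

variable {P : Type u} {A : P → Sheaf J (Type u)}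

/-- The functor taking an element `h : A p ⟶ F x`, with `A p` prime, to its filter. -/
def toSpec (hF : IsCoherentFunctor F) (hP : ∀ p, IsPrimeObject (A p)) : Elem A F ⥤ Spec C where
  obj δ := Spec.mk δ.base (factorFilter hF (hP δ.idx) δ.hom)
  map {δ ε} f := Spec.homOf f.right fun w hw => by
    obtain ⟨l, hl⟩ := (mem_factorFilter hF _ _ w).1 hw
    exact pullback_mem_factorFilter hF (hP δ.idx) δ.hom f.right (l := f.left ≫ l)
      (by rw [Category.assoc, hl, f.w])
  map_id δ := rfl
  map_comp f g := (Spec.homOf_comp f.right g.right _ _ _).symm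

end Elem

lemma coveringFamily_homOf (a : Spec C) {x : C} (f : x ⟶ a.pt) {p : PrimeFilter x}
    (hp : ∀ v ∈ a.filter.1, (Subobject.pullback f).obj v ∈ p.1) :
    coveringFamily a f (Spec.homOf f hp) :=
  Presieve.ofArrows.mk (⟨p, hp⟩ : {p : PrimeFilter x // ∀ v ∈ a.filter.1,
    (Subobject.pullback f).obj v ∈ p.1})

lemma Germ.comp_ofHom_comp_arrow {x z y : C} {p : PrimeFilter x} {q : PrimeFilter z}
    (f : PartialHom q y) (e : x ⟶ (f.dom : C))
    (h : Germ.Continuous q (Germ.ofHom p (e ≫ f.dom.arrow))) :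
    Germ.comp ⟨Germ.ofHom p (e ≫ f.dom.arrow), h⟩ (Germ.mk f) = Germ.ofHom p (e ≫ f.map) :=
  Germ.mk_eq (PartialHom.comp_rel (PartialHom.ofHom p (e ≫ f.dom.arrow)) h f
    (PartialHom.ofHom p (e ≫ f.map)) Order.PFilter.top_mem le_rfl le_rfl
    ((⊤ : Subobject x).arrow ≫ e) (by simp [PartialHom.ofHom]) (by simp [PartialHom.ofHom]))

namespace Elem

variable {P : Type u} {A : P → Sheaf J (Type u)}
  (K : GrothendieckTopology (Elem A F)) [(proj A F).IsDenseSubsite K (sheafTopology J)]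

/-- Since the primes cover, elements lift locally along effective epimorphisms. -/
lemma functorPullback_coveringFamily_mem (hF : IsCoherentFunctor F)
    (hP : ∀ p, IsPrimeObject (A p)) (hA : IsCoveringFamily A) {a : Spec C} {x : C} (f : x ⟶ a.pt)
    [EffectiveEpi f] (δ : Elem A F) (g : (toSpec hF hP).obj δ ⟶ a) :
    ((Sieve.generate (coveringFamily a f)).pullback g).functorPullback (toSpec hF hP) ∈ K δ := by
  have := hF.lex
  have := hF.effectiveEpi
  obtain ⟨g, hg⟩ := g
  induction g using Germ.ind with | h g => ?_
  obtain ⟨l, hl⟩ := (mem_factorFilter hF (hP δ.idx) δ.hom g.dom).1 g.mem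
  have : IsRegularEpi f := (isRegularEpi_iff_effectiveEpi f).2 inferInstance
  have : EffectiveEpi (pullback.snd f g.map) := (isRegularEpi_iff_effectiveEpi _).1 inferInstance
  have : Sheaf.IsLocallySurjective (F.map (pullback.snd f g.map)) :=
    (Sheaf.isLocallySurjective_iff_epi' _ _).2 inferInstance
  refine mem_of_jointImageSieve_mem fun d s => ?_
  refine J.transitive (Presheaf.imageSieve_mem J (F.map (pullback.snd f g.map)).hom
    (l.hom.app _ s)) _ ?_
  rintro e i ⟨t, ht⟩
  refine J.superset_covering ?_ (hA _ (toSection J (𝟙 e)))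
  rintro e' j ⟨⟨p, b⟩, r, hr⟩
  let σ : (yonedaSheaf J).obj e ⟶ A δ.idx := sectionEquiv.symm ((A δ.idx).obj.map i.op s)
  let τ : (yonedaSheaf J).obj e ⟶ F.obj (pullback f g.map) := sectionEquiv.symm t
  have hστ : σ ≫ l = τ ≫ F.map (pullback.snd f g.map) := by
    refine (sectionEquiv_symm_comp _ _).trans (Eq.trans ?_ (sectionEquiv_symm_comp _ _).symm)
    refine congrArg sectionEquiv.symm (Eq.trans ?_ ht.symm)
    exact NatTrans.naturality_apply l.hom i.op s
  let ε : Elem A F := ⟨p, pullback f g.map, b ≫ τ⟩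
  let k : ε ⟶ δ := ⟨b ≫ σ, pullback.snd f g.map ≫ g.dom.arrow, by
    refine (congrArg ((b ≫ σ) ≫ ·) hl).symm.trans ?_
    refine Eq.trans ?_ (congrArg ((b ≫ τ) ≫ ·) (F.map_comp _ _).symm)
    exact (Category.assoc _ _ _).trans ((congrArg (b ≫ ·) ((Category.assoc _ _ _).symm.trans
      ((congrArg (· ≫ _) hστ).trans (Category.assoc _ _ _)))).trans (Category.assoc _ _ _).symm)⟩
  refine ⟨⟨ε, k, ?_⟩, r, ?_⟩
  · let π := toSpec hF hP
    let m : Germ (π.obj ε).filter x := Germ.ofHom _ (pullback.fst f g.map)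
    have hkg : (π.map k ≫ ⟨Germ.mk g, hg⟩ : π.obj ε ⟶ a).1 = m.postcomp f := by
      refine (Germ.comp_ofHom_comp_arrow (p := (π.obj ε).filter) (q := (π.obj δ).filter) g
        (pullback.snd f g.map) (π.map k).2).trans ?_
      exact (congrArg (Germ.ofHom _) pullback.condition.symm).trans (Germ.ofHom_postcomp _ _).symm
    have hq : ∀ w ∈ a.filter.1, (Subobject.pullback f).obj w ∈ m.pushforward.1 := fun w hw =>
      (Germ.pushMem_postcomp m f w).1
        (hkg ▸ (π.map k ≫ ⟨Germ.mk g, hg⟩ : π.obj ε ⟶ a).2 w hw)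
    let n : π.obj ε ⟶ Spec.mk x m.pushforward := ⟨m, fun _ h => h⟩
    exact ⟨Spec.mk x m.pushforward, n, Spec.homOf f hq, coveringFamily_homOf a f hq,
      Subtype.ext ((Germ.comp_ofHom (q := m.pushforward) n f).trans hkg.symm)⟩
  · change σ.hom.app _ (b.hom.app _ r) = _
    dsimp only at hr
    rw [hr]
    refine (congrArg _ (map_toSection (J := J) (𝟙 e) j)).trans
      ((sectionEquiv_symm_app_toSection _ (j ≫ 𝟙 e)).trans ?_)
    rw [Category.comp_id, op_comp, Functor.map_comp_apply]

/-- The functor from elements to prime filters is cocontinuous. -/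
lemma isCocontinuous_toSpec (hF : IsCoherentFunctor F) (hP : ∀ p, IsPrimeObject (A p))
    (hA : IsCoveringFamily A) : (toSpec hF hP).IsCocontinuous K (topology C) where
  cover_lift {δ S} hS := by
    suffices h : ∀ {a : Spec C} {S : Sieve a}, S ∈ topology C a →
        ∀ (δ : Elem A F) (g : (toSpec hF hP).obj δ ⟶ a),
          (S.pullback g).functorPullback (toSpec hF hP) ∈ K δ by
      simpa using h hS δ (𝟙 _)
    intro a S hS
    induction hS with
    | of a S hS =>
      obtain ⟨x, f, hf, rfl⟩ := hS
      exact functorPullback_coveringFamily_mem K hF hP hA f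
    | top a => exact fun δ g => K.superset_covering (fun _ _ _ => trivial) (K.top_mem δ)
    | pullback a S _ b f ih =>
      intro δ g
      rw [← Sieve.pullback_comp]
      exact ih δ (g ≫ f)
    | transitive a S R _ _ hS hR =>
      intro δ g
      refine K.transitive (hS δ g) _ fun ε k hk => ?_
      refine K.superset_covering ?_ (hR hk ε (𝟙 _))
      intro ζ j hj
      simpa [Sieve.functorPullback] using hj

end Elem

end ElementFilter

/-! ### Inverse images along cocontinuous functors -/

section InverseImage

variable {B S : Type u} [SmallCategory B] [SmallCategory S] (G : B ⥤ S)
  (K : GrothendieckTopology B) (L : GrothendieckTopology S)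

/-- The inverse image functor of a cocontinuous functor of sites: precomposition followed by
sheafification. -/
def inverseImage : Sheaf L (Type u) ⥤ Sheaf K (Type u) :=
  sheafToPresheaf L (Type u) ⋙ (Functor.whiskeringLeft _ _ _).obj G.op ⋙
    presheafToSheaf K (Type u)

instance : PreservesFiniteLimits (inverseImage G K L) := by
  have : PreservesFiniteLimits ((Functor.whiskeringLeft Bᵒᵖ Sᵒᵖ (Type u)).obj G.op ⋙
      presheafToSheaf K (Type u)) := comp_preservesFiniteLimits _ _
  exact comp_preservesFiniteLimits _ _

variable [G.IsCocontinuous K L]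

/-- The inverse image functor is left adjoint to right Kan extension. -/
def inverseImageAdjunction :
    inverseImage G K L ⊣ G.sheafPushforwardCocontinuous (Type u) K L :=
  ((G.op.ranAdjunction (Type u)).comp (sheafificationAdjunction K (Type u))).restrictFullyFaithful
    (fullyFaithfulSheafToPresheaf L (Type u)) (Functor.FullyFaithful.id _)
    (Functor.rightUnitor _).symm
    ((Functor.leftUnitor _) ≪≫ (G.sheafPushforwardCocontinuousCompSheafToPresheafIso _ K L).symm)

instance : PreservesColimitsOfSize.{u, u} (inverseImage G K L) :=
  (inverseImageAdjunction G K L).leftAdjoint_preservesColimits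

/-- Inverse images commute with sheafification. -/
def sheafifyCompInverseImageIso : (Functor.whiskeringLeft _ _ _).obj G.op ⋙
    presheafToSheaf K (Type u) ≅ presheafToSheaf L (Type u) ⋙ inverseImage G K L :=
  ((G.op.ranAdjunction (Type u)).comp (sheafificationAdjunction K (Type u))).leftAdjointUniq
    (((sheafificationAdjunction L (Type u)).comp (inverseImageAdjunction G K L)).ofNatIsoRight
      (G.sheafPushforwardCocontinuousCompSheafToPresheafIso (Type u) K L))

end InverseImage

/-! ### Evaluation of germs at prime elements -/

section RestrictedYoneda

variable {D : Type u} [SmallCategory D] {J : GrothendieckTopology D} {C : Type u} [SmallCategory C]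
  {P : Type u}

namespace Elem

/-- The equivalence between sheaves and sheaves on the site of elements, taking `X` to the sheaf of
morphisms from members of the family to `X`. -/
def restrictedYoneda (F : C ⥤ Sheaf J (Type u)) (A : P → Sheaf J (Type u))
    (K : GrothendieckTopology (Elem A F)) [(proj A F).IsDenseSubsite K (sheafTopology J)] :
    Sheaf J (Type u) ⥤ Sheaf K (Type u) :=
  (sheafTopology J).yoneda ⋙
    (proj A F).sheafPushforwardContinuous (Type u) K (sheafTopology J)

variable {F : C ⥤ Sheaf J (Type u)} {A : P → Sheaf J (Type u)}
  (K : GrothendieckTopology (Elem A F)) [(proj A F).IsDenseSubsite K (sheafTopology J)]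

instance : (restrictedYoneda F A K).IsEquivalence := isEquivalence_yoneda_comp_sheafPushforward _ _

lemma restrictedYoneda_obj_map {δ ε : Elem A F} (g : ε ⟶ δ) {X : Sheaf J (Type u)}
    (f : A δ.idx ⟶ X) : ((restrictedYoneda F A K).obj X).obj.map g.op f = g.left ≫ f := rfl

end Elem

end RestrictedYoneda

section Comparison

variable {D : Type u} [SmallCategory D] {J : GrothendieckTopology D}
  {C : Type u} [SmallCategory C] [CoherentCategory C] {F : C ⥤ Sheaf J (Type u)}

/-- The value of a germ `[f] : x ⊇ w ⟶ y` at an element `h : Z ⟶ F x` that factors through `F w`. -/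
def evalGerm (hF : IsCoherentFunctor F) {Z : Sheaf J (Type u)} (hZ : IsPrimeObject Z) {x : C}
    (h : Z ⟶ F.obj x) {y : C} (g : Germ (factorFilter hF hZ h) y) : Z ⟶ F.obj y :=
  Quotient.lift (fun f : PartialHom (factorFilter hF hZ h) y =>
    ((mem_factorFilter hF hZ h f.dom).1 f.mem).choose ≫ F.map f.map) (by
      rintro f g ⟨w, hw, hf, hg, e⟩
      have := hF.lex
      obtain ⟨l, hl⟩ := (mem_factorFilter hF hZ h w).1 hw
      have key (v : Subobject x) (hv : v ∈ (factorFilter hF hZ h).1) (hwv : w ≤ v) :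
          ((mem_factorFilter hF hZ h v).1 hv).choose = l ≫ F.map (Subobject.ofLE w v hwv) := by
        rw [← cancel_mono (F.map v.arrow), Category.assoc, ← F.map_comp, Subobject.ofLE_arrow, hl]
        exact ((mem_factorFilter hF hZ h v).1 hv).choose_spec
      change _ ≫ _ = _ ≫ _
      rw [key f.dom f.mem hf, key g.dom g.mem hg, Category.assoc, Category.assoc, ← F.map_comp,
        ← F.map_comp, e]) g

section

variable (hF : IsCoherentFunctor F) {Z : Sheaf J (Type u)} (hZ : IsPrimeObject Z) {x : C}
  (h : Z ⟶ F.obj x)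

lemma evalGerm_mk {y : C} (f : PartialHom (factorFilter hF hZ h) y)
    {l : Z ⟶ F.obj (f.dom : C)} (hl : l ≫ F.map f.dom.arrow = h) :
    evalGerm hF hZ h (Germ.mk f) = l ≫ F.map f.map := by
  have := hF.lex
  refine congrArg (· ≫ F.map f.map) ((cancel_mono (F.map f.dom.arrow)).1 ?_)
  exact ((mem_factorFilter hF hZ h f.dom).1 f.mem).choose_spec.trans hl.symm

lemma evalGerm_ofHom {y : C} (f : x ⟶ y) :
    evalGerm hF hZ h (Germ.ofHom _ f) = h ≫ F.map f := by
  obtain ⟨l, hl⟩ := (mem_factorFilter hF hZ h ⊤).1 Order.PFilter.top_mem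
  refine (evalGerm_mk hF hZ h (PartialHom.ofHom _ f) hl).trans ?_
  exact (congrArg (l ≫ ·) (F.map_comp _ _)).trans ((Category.assoc _ _ _).symm.trans
    (congrArg (· ≫ F.map f) hl))

lemma evalGerm_postcomp {y z : C} (g : Germ (factorFilter hF hZ h) y) (k : y ⟶ z) :
    evalGerm hF hZ h (g.postcomp k) = evalGerm hF hZ h g ≫ F.map k := by
  induction g using Germ.ind with | h f => ?_
  obtain ⟨l, hl⟩ := (mem_factorFilter hF hZ h f.dom).1 f.mem
  rw [evalGerm_mk hF hZ h f hl, Germ.postcomp_mk,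
    evalGerm_mk hF hZ h ⟨f.dom, f.mem, f.map ≫ k⟩ hl, F.map_comp, Category.assoc]

/-- Two germs with the same value at `h` agree, since `h` factors through their equalizer. -/
lemma evalGerm_injective {y : C} :
    Function.Injective (evalGerm hF hZ h : Germ (factorFilter hF hZ h) y → (Z ⟶ F.obj y)) := by
  have := hF.lex
  intro a b hab
  induction a using Germ.ind with | h f => ?_
  induction b using Germ.ind with | h g => ?_
  obtain ⟨l, hl⟩ := (mem_factorFilter hF hZ h (f.dom ⊓ g.dom)).1
    (Order.PFilter.inf_mem f.mem g.mem)
  let a := Subobject.ofLE (f.dom ⊓ g.dom) f.dom inf_le_left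
  let b := Subobject.ofLE (f.dom ⊓ g.dom) g.dom inf_le_right
  have ha : (l ≫ F.map a) ≫ F.map f.dom.arrow = h := by
    rw [Category.assoc, ← F.map_comp, Subobject.ofLE_arrow, hl]
  have hb : (l ≫ F.map b) ≫ F.map g.dom.arrow = h := by
    rw [Category.assoc, ← F.map_comp, Subobject.ofLE_arrow, hl]
  rw [evalGerm_mk hF hZ h f ha, evalGerm_mk hF hZ h g hb, Category.assoc, Category.assoc,
    ← F.map_comp, ← F.map_comp] at hab
  obtain ⟨m, hm⟩ := Elem.exists_lift_equalizer F (a ≫ f.map) (b ≫ g.map) l hab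
  let i := equalizer.ι (a ≫ f.map) (b ≫ g.map)
  let w := Subobject.mk (i ≫ (f.dom ⊓ g.dom).arrow)
  let j : (w : C) ⟶ equalizer (a ≫ f.map) (b ≫ g.map) := (Subobject.underlyingIso _).hom
  have hj : j ≫ i ≫ (f.dom ⊓ g.dom).arrow = w.arrow := Subobject.underlyingIso_hom_comp_eq_mk _
  have hw : w ≤ f.dom ⊓ g.dom := Subobject.mk_le_of_comm i rfl
  have hij : Subobject.ofLE w _ hw = j ≫ i := by
    rw [← cancel_mono (f.dom ⊓ g.dom).arrow, Subobject.ofLE_arrow, Category.assoc, hj]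
  refine Germ.mk_eq ⟨w, (mem_factorFilter hF hZ h w).2
    ⟨m ≫ F.map (Subobject.underlyingIso (i ≫ (f.dom ⊓ g.dom).arrow)).inv, ?_⟩,
    hw.trans inf_le_left, hw.trans inf_le_right, ?_⟩
  · rw [Category.assoc, ← F.map_comp, Subobject.underlyingIso_arrow, F.map_comp,
      ← Category.assoc, hm, hl]
  · rw [← Subobject.ofLE_comp_ofLE _ _ _ hw inf_le_left,
      ← Subobject.ofLE_comp_ofLE _ _ _ hw inf_le_right, hij]
    simp only [Category.assoc]
    exact congrArg (j ≫ ·) (equalizer.condition _ _)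

end

namespace Elem

variable {P : Type u} {A : P → Sheaf J (Type u)} (hF : IsCoherentFunctor F)
  (hP : ∀ p, IsPrimeObject (A p))

/-- Evaluation of germs is natural in the element at which they are evaluated. -/
lemma evalGerm_comp {δ ε : Elem A F} (k : δ ⟶ ε) {y : C}
    (g : Germ (factorFilter hF (hP ε.idx) ε.hom) y) :
    evalGerm hF (hP δ.idx) δ.hom (Germ.comp ((toSpec hF hP).map k) g) =
      k.left ≫ evalGerm hF (hP ε.idx) ε.hom g := by
  have := hF.lex
  induction g using Germ.ind with | h g => ?_
  obtain ⟨l, hl⟩ := (mem_factorFilter hF _ _ _).1 g.mem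
  let r : PartialHom (factorFilter hF (hP δ.idx) δ.hom) ε.base := PartialHom.ofHom _ k.right
  obtain ⟨l', hl'⟩ := (mem_factorFilter hF (hP δ.idx) δ.hom (r.preimage g.dom)).1
    (((toSpec hF hP).map k).2 g.dom g.mem)
  have h : l' ≫ F.map (r.restrict g.dom) = k.left ≫ l := by
    rw [← cancel_mono (F.map g.dom.arrow), Category.assoc, Category.assoc, ← F.map_comp,
      r.restrict_arrow, hl, k.w]
    refine Eq.trans ?_ (congrArg (· ≫ F.map k.right) hl')
    refine Eq.trans ?_ (Category.assoc _ _ _).symm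
    refine congrArg (l' ≫ ·) (Eq.trans (congrArg F.map ?_) (F.map_comp _ _))
    exact (Category.assoc _ _ _).symm.trans (congrArg (· ≫ k.right) (Subobject.ofLE_arrow _))
  refine (evalGerm_mk hF (hP δ.idx) δ.hom ⟨r.preimage g.dom, _, r.restrict g.dom ≫ g.map⟩
    hl').trans ?_
  rw [evalGerm_mk hF _ _ g hl, ← Category.assoc, ← h, Category.assoc, F.map_comp]

variable (K : GrothendieckTopology (Elem A F)) [(proj A F).IsDenseSubsite K (sheafTopology J)]

/-- Evaluation of germs, as a natural transformation. -/
def evalGermTrans : germFunctor C ⋙ (Functor.whiskeringLeft _ _ _).obj (toSpec hF hP).op ⟶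
    F ⋙ restrictedYoneda F A K ⋙ sheafToPresheaf K (Type u) where
  app y :=
    { app := fun δ => TypeCat.ofHom fun g => evalGerm hF (hP δ.unop.idx) δ.unop.hom g
      naturality := fun δ ε k => by
        ext g
        exact evalGerm_comp hF hP k.unop g }
  naturality y z f := by
    ext δ g
    exact evalGerm_postcomp hF (hP δ.unop.idx) δ.unop.hom g f

instance (y : C) : Presheaf.IsLocallyInjective K ((evalGermTrans hF hP K).app y) :=
  ⟨fun {δ} a b hab => by
    rw [evalGerm_injective hF (hP δ.unop.idx) δ.unop.hom hab, Presheaf.equalizerSieve_self_eq_top]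
    exact K.top_mem _⟩

/-- Locally, every morphism to `F y` from the prime on which an element is defined is the value of
the germ of a projection. -/
instance (y : C) : Presheaf.IsLocallySurjective K ((evalGermTrans hF hP K).app y) :=
  ⟨fun {δ} k => by
    have := hF.lex
    change A δ.idx ⟶ F.obj y at k
    obtain ⟨m, h₁, h₂⟩ := exists_lift_prod F δ.hom k
    let g : (⟨δ.idx, _, m⟩ : Elem A F) ⟶ δ := ⟨𝟙 _, prod.fst, by rw [h₁, Category.id_comp]⟩
    refine mem_of_left_eq_id g rfl ⟨Germ.ofHom _ prod.snd, ?_⟩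
    exact (evalGerm_ofHom hF (hP δ.idx) m prod.snd).trans (h₂.trans (Category.id_comp k).symm)⟩

end Elem

end Comparison

/-! ### The extension of a coherent functor -/

section InverseImage

variable {B S : Type u} [SmallCategory B] [SmallCategory S] (G : B ⥤ S)
  (K : GrothendieckTopology B) (L : GrothendieckTopology S) [G.IsCocontinuous K L]

/-- The sections of the inverse image of the sheafification of `X` that are given by sections of
`X`. -/
def inverseImageUnit (X : Sᵒᵖ ⥤ Type u) :
    G.op ⋙ X ⟶ ((inverseImage G K L).obj ((presheafToSheaf L (Type u)).obj X)).obj :=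
  toSheafify K (G.op ⋙ X) ≫ ((sheafifyCompInverseImageIso G K L).hom.app X).hom

lemma inverseImageUnit_naturality {X Y : Sᵒᵖ ⥤ Type u} (f : X ⟶ Y) :
    Functor.whiskerLeft G.op f ≫ inverseImageUnit G K L Y = inverseImageUnit G K L X ≫
      ((inverseImage G K L).map ((presheafToSheaf L (Type u)).map f)).hom := by
  have h := congrArg (·.hom) ((sheafifyCompInverseImageIso G K L).hom.naturality f)
  refine (Category.assoc _ _ _).symm.trans ?_
  refine (congrArg (· ≫ _) (toSheafify_naturality K (Functor.whiskerLeft G.op f))).trans ?_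
  exact (Category.assoc _ _ _).trans ((congrArg (_ ≫ ·) h).trans (Category.assoc _ _ _).symm)

end InverseImage

section Comparison

variable {D : Type u} [SmallCategory D] {J : GrothendieckTopology D}
  {C : Type u} [SmallCategory C] [CoherentCategory C] {F : C ⥤ Sheaf J (Type u)}

namespace Elem

variable {P : Type u} {A : P → Sheaf J (Type u)} (hF : IsCoherentFunctor F)
  (hP : ∀ p, IsPrimeObject (A p))
  (K : GrothendieckTopology (Elem A F)) [(proj A F).IsDenseSubsite K (sheafTopology J)]

/-- The map induced by evaluation of germs on sheafifications. -/
def sheafifiedEvalGermTrans : germFunctor C ⋙ (Functor.whiskeringLeft _ _ _).obj (toSpec hF hP).op ⋙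
    presheafToSheaf K (Type u) ⟶ F ⋙ restrictedYoneda F A K :=
  Functor.whiskerRight (evalGermTrans hF hP K) (presheafToSheaf K (Type u)) ≫
    Functor.whiskerLeft (F ⋙ restrictedYoneda F A K) (sheafificationAdjunction K (Type u)).counit

instance : IsIso (sheafifiedEvalGermTrans hF hP K) := by
  have (y : C) : IsIso ((sheafifiedEvalGermTrans hF hP K).app y) := by
    have : IsIso ((presheafToSheaf K (Type u)).map ((evalGermTrans hF hP K).app y)) :=
      (K.W_iff _).1 (K.W_of_isLocallyBijective _)
    exact inferInstanceAs (IsIso ((presheafToSheaf K (Type u)).map ((evalGermTrans hF hP K).app y) ≫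
      (sheafificationAdjunction K (Type u)).counit.app ((F ⋙ restrictedYoneda F A K).obj y)))
  exact NatIso.isIso_of_isIso_app _

lemma toSheafify_sheafifiedEvalGermTrans (y : C) :
    toSheafify K ((toSpec hF hP).op ⋙ germPresheaf y) ≫
      ((sheafifiedEvalGermTrans hF hP K).app y).hom = (evalGermTrans hF hP K).app y := by
  have h := (sheafificationAdjunction K (Type u)).unit.naturality ((evalGermTrans hF hP K).app y)
  refine (Category.assoc _ _ _).symm.trans ((congrArg (· ≫ _) h.symm).trans ?_)
  refine (Category.assoc _ _ _).trans ((congrArg (_ ≫ ·) ?_).trans (Category.comp_id _))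
  exact (sheafificationAdjunction K (Type u)).right_triangle_components _

variable [(toSpec hF hP).IsCocontinuous K (topology C)]

/-- The inverse image functor along the functor from elements to prime filters extends `F`, seen as
a functor to sheaves on the site of elements. -/
def phiCompInverseImageIso : phi C ⋙ inverseImage (toSpec hF hP) K (topology C) ≅
    F ⋙ restrictedYoneda F A K :=
  Functor.isoWhiskerLeft (germFunctor C)
    (sheafifyCompInverseImageIso (toSpec hF hP) K (topology C)).symm ≪≫
    asIso (sheafifiedEvalGermTrans hF hP K)

lemma inverseImageUnit_phiCompInverseImageIso (y : C) :
    inverseImageUnit (toSpec hF hP) K (topology C) (germPresheaf y) ≫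
      ((phiCompInverseImageIso hF hP K).hom.app y).hom = (evalGermTrans hF hP K).app y := by
  have h := congrArg (·.hom) ((sheafifyCompInverseImageIso (toSpec hF hP) K
    (topology C)).hom_inv_id_app_assoc (germPresheaf y) ((sheafifiedEvalGermTrans hF hP K).app y))
  exact (Category.assoc _ _ _).trans ((congrArg (_ ≫ ·) h).trans
    (toSheafify_sheafifiedEvalGermTrans hF hP K y))

/-- The sections over `δ` of the inverse image of `φ y` are the morphisms to `F y` from the prime on
which `δ` is defined. -/
def sectionHom (δ : Elem A F) (y : C)
    (s : ((inverseImage (toSpec hF hP) K (topology C)).obj ((phi C).obj y)).obj.obj (op δ)) :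
    A δ.idx ⟶ F.obj y :=
  ((phiCompInverseImageIso hF hP K).hom.app y).hom.app (op δ) s

lemma sectionHom_injective (δ : Elem A F) (y : C) :
    Function.Injective (sectionHom hF hP K δ y) :=
  ((isIso_iff_bijective _).1 (inferInstanceAs (IsIso (((sheafToPresheaf K (Type u)).map
    ((phiCompInverseImageIso hF hP K).hom.app y)).app (op δ))))).1

lemma sectionHom_map_app (δ : Elem A F) {x y : C} (f : x ⟶ y)
    (s : ((inverseImage (toSpec hF hP) K (topology C)).obj ((phi C).obj x)).obj.obj (op δ)) :
    sectionHom hF hP K δ y (((inverseImage (toSpec hF hP) K (topology C)).map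
      ((phi C).map f)).hom.app (op δ) s) = sectionHom hF hP K δ x s ≫ F.map f :=
  congrArg (fun t => t.hom.app (op δ) s) ((phiCompInverseImageIso hF hP K).hom.naturality f)

lemma sectionHom_map {δ ε : Elem A F} (g : ε ⟶ δ) (y : C)
    (s : ((inverseImage (toSpec hF hP) K (topology C)).obj ((phi C).obj y)).obj.obj (op δ)) :
    sectionHom hF hP K ε y (((inverseImage (toSpec hF hP) K (topology C)).obj
      ((phi C).obj y)).obj.map g.op s) = g.left ≫ sectionHom hF hP K δ y s :=
by
  let e := ((phiCompInverseImageIso hF hP K).hom.app y).hom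
  have h := NatTrans.naturality_apply e g.op s
  refine Eq.trans (b := ((restrictedYoneda F A K).obj (F.obj y)).obj.map g.op (e.app (op δ) s)) ?_
    (restrictedYoneda_obj_map K g _)
  unfold sectionHom
  exact h

lemma sectionHom_inverseImageUnit (δ : Elem A F) (y : C)
    (t : Germ (factorFilter hF (hP δ.idx) δ.hom) y) :
    sectionHom hF hP K δ y ((inverseImageUnit (toSpec hF hP) K (topology C)
      (germPresheaf y)).app (op δ) t) = evalGerm hF (hP δ.idx) δ.hom t :=
  congrArg (fun u => u.app (op δ) t) (inverseImageUnit_phiCompInverseImageIso hF hP K y)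

/-- If `k : Z ⟶ F x` factors through `F w` for all `w` in a prime filter `p`, then `p` is contained
in the filter of `k`, so that `[id]` is a germ `(x, p') ⟶ (x, p)` that evaluates to `k`. -/
lemma preservesFilterInter_inverseImage :
    PreservesFilterInter (inverseImage (toSpec hF hP) K (topology C)) := by
  have := hF.lex
  intro a Z k hk
  let N := inverseImage (toSpec hF hP) K (topology C)
  have : Mono (N.map (sheafInclusion a)) := inferInstance
  refine exists_comp_eq_of_locally (N.map (sheafInclusion a)) k fun δ z => ?_
  let κ : A δ.idx ⟶ F.obj a.pt := sectionHom hF hP K δ a.pt (k.hom.app _ z)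
  have hκ (w : Subobject a.pt) (hw : w ∈ a.filter.1) :
      ∃ l : A δ.idx ⟶ F.obj (w : C), l ≫ F.map w.arrow = κ := by
    obtain ⟨l, rfl⟩ := hk w hw
    exact ⟨sectionHom hF hP K δ _ (l.hom.app _ z),
      (sectionHom_map_app hF hP K δ w.arrow (l.hom.app _ z)).symm⟩
  obtain ⟨m, h₁, h₂⟩ := exists_lift_prod F δ.hom κ
  let ζ : Elem A F := ⟨δ.idx, _, m⟩
  let g : ζ ⟶ δ := ⟨𝟙 _, prod.fst, by rw [h₁, Category.id_comp]⟩
  let σ : (toSpec hF hP).obj ζ ⟶ a := Spec.homOf (q := a.filter) prod.snd fun w hw => by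
    obtain ⟨l, hl⟩ := hκ w hw
    exact pullback_mem_factorFilter hF (hP δ.idx) m prod.snd (hl.trans h₂.symm)
  refine mem_of_left_eq_id g rfl
    ⟨(), (inverseImageUnit (toSpec hF hP) K (topology C) (yoneda.obj a)).app (op ζ) σ, ?_⟩
  apply sectionHom_injective hF hP K ζ a.pt
  have h := congrArg (fun t => t.app (op ζ) σ)
    (inverseImageUnit_naturality (toSpec hF hP) K (topology C) (germInclusion a))
  refine (congrArg (sectionHom hF hP K ζ a.pt) h.symm).trans ?_
  refine (sectionHom_inverseImageUnit hF hP K ζ a.pt (Germ.ofHom _ prod.snd)).trans ?_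
  refine (evalGerm_ofHom hF (hP δ.idx) m prod.snd).trans (h₂.trans ?_)
  exact ((sectionHom_map hF hP K g a.pt _).trans (Category.id_comp κ)).symm

end Elem

end Comparison

section Transport

variable {C : Type u} [SmallCategory C] [CoherentCategory C] {E : Type u₁} [Category.{v₁} E]
  {E' : Type*} [Category* E']

/-- The property `PreservesFilterInter` is reflected by fully faithful functors. -/
lemma PreservesFilterInter.of_comp {M : SpecTopos C ⥤ E} (G : E ⥤ E') [G.Full] [G.Faithful]
    (h : PreservesFilterInter (M ⋙ G)) : PreservesFilterInter M := by
  intro a Z k hk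
  obtain ⟨l, hl⟩ := h a (G.map k) fun w hw => by
    obtain ⟨l, hl⟩ := hk w hw
    exact ⟨G.map l, by rw [← hl, G.map_comp]; rfl⟩
  exact ⟨G.preimage l, G.map_injective (by rw [G.map_comp, G.map_preimage]; exact hl)⟩

lemma PreservesFilterInter.comp {M : SpecTopos C ⥤ E} (hM : PreservesFilterInter M) (G : E ⥤ E')
    [G.IsEquivalence] : PreservesFilterInter (M ⋙ G) := by
  intro a Z k hk
  let i := G.objObjPreimageIso Z
  obtain ⟨l, hl⟩ := hM a (G.preimage (i.hom ≫ k)) fun w hw => by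
    obtain ⟨l, hl⟩ := hk w hw
    refine ⟨G.preimage (i.hom ≫ l), G.map_injective ?_⟩
    rw [G.map_comp, G.map_preimage, G.map_preimage, ← hl, Category.assoc]
    rfl
  refine ⟨i.inv ≫ G.map l, ?_⟩
  change (i.inv ≫ G.map l) ≫ G.map (M.map _) = k
  rw [Category.assoc, ← G.map_comp, hl, G.map_preimage, Iso.inv_hom_id_assoc]

lemma PreservesFilterInter.isPInfLexCocontinuous {M : SpecTopos C ⥤ E} [PreservesFiniteLimits M]
    [PreservesColimitsOfSize.{u, u} M] (hM : PreservesFilterInter M) :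
    IsPInfLexCocontinuous C M :=
  ⟨inferInstance, inferInstance, fun p pinf h hp => hM.nonempty_isLimit p pinf h hp⟩

lemma IsPInfLexCocontinuous.comp {M : SpecTopos C ⥤ E} (hM : IsPInfLexCocontinuous C M)
    (G : E ⥤ E') [G.IsEquivalence] : IsPInfLexCocontinuous C (M ⋙ G) := by
  have := hM.lex
  have := hM.cocontinuous
  exact ⟨comp_preservesFiniteLimits _ _, inferInstance, fun p pinf h hp =>
    ⟨isLimitOfPreserves G (hM.chain p pinf h hp).some⟩⟩

end Transport

section Extend

variable {D : Type u} [SmallCategory D] {J : GrothendieckTopology D}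
  {C : Type u} [SmallCategory C] [CoherentCategory C] {F : C ⥤ Sheaf J (Type u)}

/-- Coherent functors to a topos of sheaves generated by primes extend along `φ`. -/
lemma IsCoherentFunctor.exists_extension_sheaf (hJ : IsPrimeGenerated (Sheaf J (Type u)))
    (hF : IsCoherentFunctor F) : ∃ M : SpecTopos C ⥤ Sheaf J (Type u),
      IsPInfLexCocontinuous C M ∧ Nonempty (phi C ⋙ M ≅ F) := by
  have := hF.lex
  obtain ⟨P, A, hP, hA⟩ := exists_isCoveringFamily hJ
  have := Elem.isCoverDense_proj (F := F) hA
  have := Elem.isLocallyFull_proj (A := A) (F := F) (sheafTopology J)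
  have := Elem.isLocallyFaithful_proj (A := A) (F := F) (sheafTopology J)
  let K := (Elem.proj A F).restrictedTopology (sheafTopology J)
  have : (Elem.toSpec hF hP).IsCocontinuous K (topology C) := Elem.isCocontinuous_toSpec K hF hP hA
  let N := inverseImage (Elem.toSpec hF hP) K (topology C)
  let R := Elem.restrictedYoneda F A K
  have hN : PreservesFilterInter (N ⋙ R.inv) :=
    (Elem.preservesFilterInter_inverseImage hF hP K).comp R.inv
  have : PreservesFiniteLimits (N ⋙ R.inv) := comp_preservesFiniteLimits _ _
  exact ⟨N ⋙ R.inv, hN.isPInfLexCocontinuous,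
    ⟨Functor.isoWhiskerRight (Elem.phiCompInverseImageIso hF hP K) R.inv ≪≫
      Functor.isoWhiskerLeft F R.asEquivalence.unitIso.symm ≪≫ F.rightUnitor⟩⟩

end Extend

/-! ### The equivalence -/

section Equivalences

variable {C : Type*} [Category* C] {D : Type*} [Category* D] {E : Type*} [Category* E]

/-- An equivalence of categories induces order isomorphisms of posets of subobjects. -/
def mapSubobjectOrderIso (G : D ⥤ E) [G.IsEquivalence] (X : D) :
    Subobject X ≃o Subobject (G.obj X) :=
  RelIso.ofSurjective (OrderEmbedding.ofMapLEIff (mapSubobject G) fun u w => by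
    refine ⟨fun h => Subobject.le_of_comm (G.preimage (Subobject.ofMkLEMk _ _ h))
      (G.map_injective ?_), fun h => Subobject.mk_le_mk_of_comm (G.map (Subobject.ofLE u w h)) ?_⟩
    · exact (G.map_comp _ _).trans ((congrArg (· ≫ _) (G.map_preimage _)).trans
        (Subobject.ofMkLEMk_comp h))
    · rw [← G.map_comp, Subobject.ofLE_arrow]) fun w => by
    let i := G.objObjPreimageIso (w : E)
    have : Mono (G.map (G.preimage (i.hom ≫ w.arrow))) := by
      rw [G.map_preimage]
      infer_instance
    have := G.mono_of_mono_map this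
    let v := G.preimage (i.hom ≫ w.arrow)
    refine ⟨Subobject.mk v, (Subobject.mk_eq_mk_of_comm _ w.arrow
      (G.mapIso (Subobject.underlyingIso v) ≪≫ i) ?_).trans (Subobject.mk_arrow w)⟩
    rw [← Subobject.underlyingIso_hom_comp_eq_mk, G.map_comp, G.map_preimage]
    exact Category.assoc _ _ _

lemma mapSubobject_comp (F : C ⥤ D) [F.PreservesMonomorphisms] (G : D ⥤ E)
    [G.PreservesMonomorphisms] {x : C} (u : Subobject x) :
    mapSubobject (F ⋙ G) u = mapSubobject G (mapSubobject F u) :=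
  Subobject.mk_eq_mk_of_comm _ _ (G.mapIso (Subobject.underlyingIso (F.map u.arrow)).symm)
    ((G.map_comp _ _).symm.trans (congrArg G.map (Subobject.underlyingIso_arrow _)))

lemma IsCoherentFunctor.comp_isEquivalence {F : C ⥤ D} (hF : IsCoherentFunctor F) (G : D ⥤ E)
    [G.IsEquivalence] : IsCoherentFunctor (F ⋙ G) := by
  have := hF.lex
  have := hF.effectiveEpi
  exact
    { lex := comp_preservesFiniteLimits _ _
      effectiveEpi := ⟨fun f _ => inferInstanceAs (EffectiveEpi (G.map (F.map f)))⟩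
      isBot := fun {x} w hw => by
        rw [mapSubobject_comp]
        exact (mapSubobjectOrderIso G (F.obj x)).surjective.forall.2 fun v =>
          (mapSubobjectOrderIso G (F.obj x)).monotone (hF.isBot w hw v)
      isLUB := fun {x} u v w hw => by
        rw [mapSubobject_comp, mapSubobject_comp, mapSubobject_comp]
        have h := (mapSubobjectOrderIso G (F.obj x)).isLUB_image'.2 (hF.isLUB u v w hw)
        rwa [Set.image_pair] at h }

lemma IsPrimeSubobject.map_orderIso {X : D} {Y : E} (σ : Subobject X ≃o Subobject Y)
    {a : Subobject X} (ha : IsPrimeSubobject a) : IsPrimeSubobject (σ a) := by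
  intro T hT
  have h : IsLUB (σ ⁻¹' T) a := by
    rw [← σ.isLUB_image', Set.image_preimage_eq _ σ.surjective]
    exact hT
  exact ha _ h

lemma IsPrimeGenerated.of_isEquivalence (hD : IsPrimeGenerated D) (G : D ⥤ E) [G.IsEquivalence] :
    IsPrimeGenerated E := by
  intro Y
  obtain ⟨S, hS, hST⟩ := hD (G.objPreimage Y)
  let σ := (mapSubobjectOrderIso G (G.objPreimage Y)).trans
    (Subobject.mapIsoToOrderIso (G.objObjPreimageIso Y))
  refine ⟨σ '' S, ?_, ?_⟩
  · rintro _ ⟨a, ha, rfl⟩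
    exact (hS a ha).map_orderIso σ
  · rw [← σ.map_top, σ.isLUB_image']
    exact hST

end Equivalences

section Main

variable {C : Type u} [SmallCategory C] [CoherentCategory C] {E : Type u₁} [Category.{v₁} E]
  {D : Type u} [SmallCategory D] {J : GrothendieckTopology D}

lemma IsCoherentFunctor.exists_extension (e : E ≌ Sheaf J (Type u)) (hE : IsPrimeGenerated E)
    {F : C ⥤ E} (hF : IsCoherentFunctor F) :
    ∃ M : SpecTopos C ⥤ E, IsPInfLexCocontinuous C M ∧ Nonempty (phi C ⋙ M ≅ F) := by
  obtain ⟨M, hM, ⟨i⟩⟩ := (hF.comp_isEquivalence e.functor).exists_extension_sheaf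
    (hE.of_isEquivalence e.functor)
  exact ⟨M ⋙ e.inverse, hM.comp e.inverse, ⟨Functor.isoWhiskerRight i e.inverse ≪≫
    Functor.isoWhiskerLeft F e.unitIso.symm ≪≫ F.rightUnitor⟩⟩

lemma IsPInfLexCocontinuous.preservesFilterInter_of_equivalence (e : E ≌ Sheaf J (Type u))
    (hE : IsPrimeGenerated E) {M : SpecTopos C ⥤ E} (hM : IsPInfLexCocontinuous C M) :
    PreservesFilterInter M :=
  ((hM.comp e.functor).preservesFilterInter (hE.of_isEquivalence e.functor)).of_comp e.functor

end Main

end PrimeSpec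

end

theorem theorem4 (C : Type u) [SmallCategory C] [PrimeSpec.CoherentCategory C] :
    PrimeSpec.IsCoherentFunctor (PrimeSpec.phi C) ∧
    ∀ (E : Type u₁) [Category.{u} E], PrimeSpec.IsGrothendieckTopos.{u} E →
      PrimeSpec.IsPrimeGenerated E →
      ∃ h : ∀ M : (PrimeSpec.pInfLexCocontinuousFunctors C E).FullSubcategory,
          PrimeSpec.coherentFunctors C E ((PrimeSpec.precompPhi C E).obj M),
        ((PrimeSpec.coherentFunctors C E).lift (PrimeSpec.precompPhi C E) h).IsEquivalence := by
  refine ⟨PrimeSpec.isCoherentFunctor_phi_comp (C := C) (𝟭 _), fun E _ hE hE' => ?_⟩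
  obtain ⟨D, _, J, ⟨e⟩⟩ := hE.exists_site
  have : HasColimitsOfSize.{u, u} E := Adjunction.has_colimits_of_equivalence e.functor
  have : HasFiniteLimits E :=
    ⟨fun K _ _ => Adjunction.hasLimitsOfShape_of_equivalence e.functor⟩
  have h (M : (PrimeSpec.pInfLexCocontinuousFunctors C E).FullSubcategory) :
      PrimeSpec.coherentFunctors C E ((PrimeSpec.precompPhi C E).obj M) := by
    have := M.property.lex
    have := M.property.cocontinuous
    exact PrimeSpec.isCoherentFunctor_phi_comp M.obj
  refine ⟨h, ?_⟩
  have hfaithful : ((PrimeSpec.coherentFunctors C E).lift (PrimeSpec.precompPhi C E) h).Faithful :=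
    ⟨fun {M M'} β γ hβγ => by
      have := M.property.cocontinuous
      have := M'.property.lex
      exact ObjectProperty.hom_ext _
        (PrimeSpec.natTrans_ext_of_whiskerLeft_phi (congrArg (·.hom) hβγ))⟩
  have hfull : ((PrimeSpec.coherentFunctors C E).lift (PrimeSpec.precompPhi C E) h).Full :=
    ⟨fun {M M'} α => by
      have := M.property.cocontinuous
      have := M'.property.lex
      obtain ⟨γ, hγ⟩ := (M'.property.preservesFilterInter_of_equivalence e hE').exists_natTrans
        (M := M.obj) α.hom
      exact ⟨ObjectProperty.homMk γ, ObjectProperty.hom_ext _ hγ⟩⟩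
  have hess : ((PrimeSpec.coherentFunctors C E).lift (PrimeSpec.precompPhi C E) h).EssSurj :=
    ⟨fun F => by
      obtain ⟨M, hM, ⟨i⟩⟩ := F.property.exists_extension e hE'
      exact ⟨⟨M, hM⟩, ⟨(PrimeSpec.coherentFunctors C E).isoMk i⟩⟩⟩
  exact { }
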